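/- Let $\mathbb K$ be a field of characteristic $0$ and let $\mathcal A$ be a commutative, associative, unital $\mathbb K$-algebra with a $\mathbb K$-linear map $R:\mathcal A\to\mathcal A$ satisfying the Rota–Baxter relation $R(x)R(y)+R(xy)=R(R(x)y+xR(y))$. Put $\tilde R=\mathrm{id}-R$, and let $\mathcal A_R$ be the double of $\mathcal A$, with product $a*_Rb=R(a)b+aR(b)-ab$. Let $\mathcal H$ be the Hopf algebra of rooted trees: the polynomial algebra over $\mathbb K$ on the isomorphism classes of non-empty finite rooted trees, graded by the number of vertices, with counit $\epsilon$ ($\epsilon(T)=0$ for every tree $T$) and with the algebra morphism $\Delta(T)=T\otimes1+1\otimes T+\sum_{c\in C_T}P_c\otimes R_c$ as coproduct. Here $C_T$ is the set of non-empty admissible cuts of $T$ (non-empty sets of edges which every path from the root meets at most once), $R_c$ is the component of the root after removing $c$, and $P_c$ is the product of the other components. For linear maps $f,g:\mathcal H\to\mathcal A$ let $f\star g=m_{\mathcal A}(f\otimes g)\Delta$, with unit $\epsilon 1_{\mathcal A}$, let $\mathcal R(f)=R\circ f$, $\tilde{\mathcal R}(f)=\tilde R\circ f$, and let $f\star_R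 g=f\star\mathcal R(g)+\mathcal R(f)\star g-f\star g$ be the convolution product of maps into $\mathcal A_R$. Let $\exp^\star$, $\log^\star$, $\exp^{\star_R}$ be the corresponding exponentials and logarithm; the exponentials are applied to maps vanishing at $1$ and the logarithm to maps with value $1$ at $1$, so that all sums are finite on each element. As $\mathcal A_R$ need not have a unit, $\exp^{\star_R}$ is considered only on $\ker\epsilon$, where its term of order $0$ vanishes. A character is a unital multiplicative linear map $\mathcal H\to\mathcal A$; an infinitesimal character is a linear map $Z:\mathcal H\to\mathcal A$ with $Z(xy)=Z(x)\epsilon(y)+\epsilon(x)Z(y)$. Write $\mathrm{BCH}(a,b)=\log^\star(\exp^\star(a)\star\exp^\star(b))-a-b=\tfrac12[a,b]+\cdots$ for the Baker–Campbell–Hausdorff series without its linear part. Then $\exp^\star$ is a bijection from infinitesimal characters to characters. Moreover, let $Z$ be an infinitesimal character and $\phi=\exp^\star(Z)$. There is a unique infinitesimal character $\chi=\chi(Z)$ with $$\chi=Z-\mathrm{BCH}\big(\mathcal R(\chi),\tilde{\mathcal R}(\chi)\big).$$ Let $b[\phi]=\exp^{\star_R}(-\chi(Z))$ be the Bogoliubov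 character, and let $\phi_-=\exp^\star(-\mathcal R(\chi(Z)))$, $\phi_+=\exp^\star(\tilde{\mathcal R}(\chi(Z)))$. Then: 1. $\phi_-$ and $\phi_+$ are characters, $\exp^\star(\mathcal R(\chi(Z)))$ is the two-sided $\star$-inverse $\phi_-^{-1}$ of $\phi_-$, and $\phi=\phi_-^{-1}\star\phi_+$ (Birkhoff decomposition). 2. On $\ker\epsilon$ the map $b[\phi]$ is multiplicative with values in $\mathcal A_R$, that is $b[\phi](xy)=b[\phi](x)*_Rb[\phi](y)$ for $x,y\in\ker\epsilon$, and $\phi_-=\mathcal R(b[\phi])$, $\phi_+=-\tilde{\mathcal R}(b[\phi])$ on $\ker\epsilon$. 3. For every $m\ge 0$ and every $x\in\ker\epsilon$ that is homogeneous of degree $m$ (for instance a rooted tree with $m$ vertices), with $$M(x)=\sum_{n=0}^{m}\frac1{n!}\sum_{j=1}^{n-1}\binom nj\Big(\mathcal R(-\chi(Z))^{\star(n-j)}\star Z^{\star j}\Big)(x),$$ one has $\phi_-(x)=-R\big(\phi(x)+M(x)\big)$ and $\phi_+(x)=\tilde R\big(\phi(x)+M(x)\big)$. 4. For every rooted tree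 $T$, $$\phi_-(T)=-R\Big(\phi(T)+\sum_{c\in C_T}\phi_-(P_c)\,\phi(R_c)\Big),\qquad \phi_+(T)=\tilde R\Big(\phi(T)+\sum_{c\in C_T}\phi_-(P_c)\,\phi(R_c)\Big).$$ -/

import Mathlib

open scoped TensorProduct

noncomputable section

/-- Plane representatives of finite rooted trees: `node n c` has a root with the `n` ordered
branches `c 0, …, c (n - 1)`; in particular `node 0 _` is the one-vertex tree. -/
inductive PTree : Type
  | node (n : ℕ) (c : Fin n → PTree) : PTree

namespace PTree

/-- Isomorphism of rooted trees (no planarity): a bijection of the branches at the root together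
with isomorphisms of corresponding branches. -/
inductive Iso : PTree → PTree → Prop
  | node {n m : ℕ} {c : Fin n → PTree} {d : Fin m → PTree} (σ : Fin n ≃ Fin m)
      (h : ∀ i, Iso (c i) (d (σ i))) : Iso (PTree.node n c) (PTree.node m d)

theorem Iso.refl : ∀ t : PTree, Iso t t
  | PTree.node _ c => Iso.node (Equiv.refl _) fun i => Iso.refl (c i)

theorem Iso.symm {s t : PTree} (h : Iso s t) : Iso t s := by
  induction h with
  | node σ _ ih =>
    refine Iso.node σ.symm fun j => ?_
    have := ih (σ.symm j)
    rwa [Equiv.apply_symm_apply] at this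

theorem Iso.trans {s t : PTree} (h : Iso s t) : ∀ {u : PTree}, Iso t u → Iso s u := by
  induction h with
  | node σ _ ih =>
    intro u hu
    cases hu with
    | node τ h' => exact Iso.node (σ.trans τ) fun i => ih i (h' (σ i))

instance isoSetoid : Setoid PTree :=
  ⟨Iso, Iso.refl, Iso.symm, fun h h' => Iso.trans h h'⟩

/-- Number of vertices. -/
def size : PTree → ℕ
  | node n c => 1 + ∑ i : Fin n, size (c i)

theorem Iso.size_eq {s t : PTree} (h : Iso s t) : size s = size t := by
  induction h with
  | node σ _ ih =>
    simp only [size]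
    exact congrArg (1 + ·) (Fintype.sum_equiv σ _ _ ih)

/-- Edges of a tree: `root i` joins the root to the root of its `i`-th branch, and
`child i e` is the edge `e` of the `i`-th branch. -/
inductive Edge : PTree → Type
  | root {n : ℕ} {c : Fin n → PTree} (i : Fin n) : Edge (node n c)
  | child {n : ℕ} {c : Fin n → PTree} (i : Fin n) (e : Edge (c i)) : Edge (node n c)

theorem Edge.finite : ∀ t : PTree, Finite (Edge t)
  | node n c => by
    have : ∀ i, Finite (Edge (c i)) := fun i => Edge.finite (c i)
    refine Finite.of_surjective
      (fun x : Σ i : Fin n, Option (Edge (c i)) =>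
        (match x with
          | ⟨i, none⟩ => Edge.root i
          | ⟨i, some e⟩ => Edge.child i e : Edge (node n c))) ?_
    intro e
    cases e with
    | root i => exact ⟨⟨i, none⟩, rfl⟩
    | child i e => exact ⟨⟨i, some e⟩, rfl⟩

instance (t : PTree) : Fintype (Edge t) :=
  haveI := Edge.finite t
  Fintype.ofFinite _

/-- `OnPath e f`: the edge `e` lies on the path that starts at the root and ends with the
edge `f` (the case `e = f` is included). -/
inductive OnPath : ∀ {t : PTree}, Edge t → Edge t → Prop
  | root_root {n : ℕ} {c : Fin n → PTree} (i : Fin n) :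
      OnPath (Edge.root i : Edge (node n c)) (Edge.root i)
  | root_child {n : ℕ} {c : Fin n → PTree} (i : Fin n) (f : Edge (c i)) :
      OnPath (Edge.root i : Edge (node n c)) (Edge.child i f)
  | child_child {n : ℕ} {c : Fin n → PTree} (i : Fin n) {e f : Edge (c i)} (h : OnPath e f) :
      OnPath (Edge.child i e : Edge (node n c)) (Edge.child i f)

/-- A set of edges is admissible if a path that starts at the root meets it at most once. -/
def Admissible {t : PTree} (C : Finset (Edge t)) : Prop :=
  ∀ f : Edge t, ∀ e ∈ C, ∀ e' ∈ C, OnPath e f → OnPath e' f → e = e'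

open Classical in
/-- The nonempty admissible cuts of a tree. (The full cut is not a set of edges.) -/
def cuts (t : PTree) : Finset (Finset (Edge t)) :=
  Finset.univ.filter fun C => C.Nonempty ∧ Admissible C

/-- The part of the tree hanging below an edge. -/
def branch : ∀ {t : PTree}, Edge t → PTree
  | node _ c, Edge.root i => c i
  | node _ _, Edge.child _ e => branch e

end PTree

/-- Isomorphism classes of (nonempty, finite) rooted trees. -/
def RTree : Type := Quotient PTree.isoSetoid

namespace RTree

/-- The isomorphism class of a plane representative. -/
def mk (t : PTree) : RTree := Quotient.mk PTree.isoSetoid t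

/-- A plane representative of an isomorphism class. -/
def rep (T : RTree) : PTree := Quotient.out T

/-- Number of vertices. -/
def size (T : RTree) : ℕ := Quotient.lift PTree.size (fun _ _ h => PTree.Iso.size_eq (show PTree.Iso _ _ from h)) T

/-- The tree obtained by connecting the roots of the given trees to a new root. -/
def graft (m : Multiset RTree) : RTree :=
  mk (PTree.node m.toList.length fun i => (m.toList.get i).rep)

end RTree

open Classical in
/-- The component of the root after removal of the edges in `C`. -/
def PTree.prune : ∀ t : PTree, Set (PTree.Edge t) → RTree
  | PTree.node n c, C =>
      RTree.graft (((Finset.univ : Finset (Fin n)).filter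
        fun i => (PTree.Edge.root i : PTree.Edge (PTree.node n c)) ∉ C).val.map
          fun i => PTree.prune (c i) {e | (PTree.Edge.child i e : PTree.Edge (PTree.node n c)) ∈ C})

/-- The algebra of rooted trees: polynomials in the isomorphism classes of rooted trees. -/
abbrev HRT (K : Type*) [Field K] : Type _ := MvPolynomial RTree K

section Hopf

variable (K : Type*) [Field K]

/-- A rooted tree as an element of the algebra of rooted trees. -/
def treeEl (t : PTree) : HRT K := MvPolynomial.X (RTree.mk t)

/-- The monomial `P_C` of the trees cut off by an admissible cut `C`. -/
def prunedPart {t : PTree} (C : Finset (PTree.Edge t)) : HRT K :=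
  ∏ e ∈ C, treeEl K (PTree.branch e)

/-- The tree `R_C` containing the root that remains after the cut `C`. -/
def rootPart {t : PTree} (C : Finset (PTree.Edge t)) : HRT K :=
  MvPolynomial.X (PTree.prune t (C : Set (PTree.Edge t)))

/-- The counit. -/
def counit : HRT K →ₐ[K] K := MvPolynomial.aeval fun _ => 0

/-- The coproduct, the algebra morphism with
`Δ T = T ⊗ 1 + 1 ⊗ T + ∑ P_C ⊗ R_C`, the sum running over the admissible cuts of `T`
(computed on a representative of `T`). -/
def coproduct : HRT K →ₐ[K] HRT K ⊗[K] HRT K :=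
  MvPolynomial.aeval fun T : RTree =>
    (MvPolynomial.X T : HRT K) ⊗ₜ[K] (1 : HRT K) + (1 : HRT K) ⊗ₜ[K] (MvPolynomial.X T : HRT K)
      + ∑ C ∈ PTree.cuts T.rep, prunedPart K C ⊗ₜ[K] rootPart K C

end Hopf

/-- Degree (total number of vertices) of a monomial, i.e. of a forest. -/
def forestDegree (s : RTree →₀ ℕ) : ℕ := s.sum fun T k => k * T.size

section Convolution

variable {K A : Type*} [Field K] [CommRing A] [Algebra K A]

/-- The convolution product of linear maps. -/
def conv (f g : HRT K →ₗ[K] A) : HRT K →ₗ[K] A :=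
  LinearMap.mul' K A ∘ₗ TensorProduct.map f g ∘ₗ (coproduct K).toLinearMap

variable (K A) in
/-- The unit of the convolution product: the counit followed by the unit of the target. -/
def convOne : HRT K →ₗ[K] A := Algebra.linearMap K A ∘ₗ (counit K).toLinearMap

/-- Convolution powers. -/
def convPow (f : HRT K →ₗ[K] A) : ℕ → (HRT K →ₗ[K] A)
  | 0 => convOne K A
  | n + 1 => conv f (convPow f n)

/-- The convolution exponential `∑ f^{⋆k} / k!`. It is used only for `f` with `f 1 = 0`, when
`f^{⋆k}` vanishes on forests with less than `k` vertices, so the sum is cut off there. -/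
def convExp (f : HRT K →ₗ[K] A) : HRT K →ₗ[K] A :=
  (MvPolynomial.basisMonomials RTree K).constr K fun s =>
    ∑ k ∈ Finset.range (forestDegree s + 1),
      ((k.factorial : K)⁻¹) • convPow f k (MvPolynomial.monomial s 1)

/-- The convolution logarithm `∑_{k ≥ 1} (-1)^{k-1} (f - ε)^{⋆k} / k`, used only for `f` with
`f 1 = 1`; the sum is cut off as for the exponential. -/
def convLog (f : HRT K →ₗ[K] A) : HRT K →ₗ[K] A :=
  (MvPolynomial.basisMonomials RTree K).constr K fun s =>
    ∑ k ∈ Finset.Icc 1 (forestDegree s),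
      ((-1 : K) ^ (k - 1) * (k : K)⁻¹) •
        convPow (f - convOne K A) k (MvPolynomial.monomial s 1)

/-- The Baker–Campbell–Hausdorff series without its linear part,
`BCH(a, b) = log (exp a ⋆ exp b) - a - b = [a, b] / 2 + ⋯`. -/
def BCH (a b : HRT K →ₗ[K] A) : HRT K →ₗ[K] A :=
  convLog (conv (convExp a) (convExp b)) - a - b

/-- Characters: unital multiplicative linear maps. -/
def IsCharacter (φ : HRT K →ₗ[K] A) : Prop :=
  φ 1 = 1 ∧ ∀ x y, φ (x * y) = φ x * φ y

/-- Infinitesimal characters: derivations with respect to the counit. -/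
def IsInfinitesimalCharacter (Z : HRT K →ₗ[K] A) : Prop :=
  ∀ x y, Z (x * y) = counit K y • Z x + counit K x • Z y

/-- Rota–Baxter maps (of weight one). -/
def IsRotaBaxter (R : A →ₗ[K] A) : Prop :=
  ∀ x y, R x * R y + R (x * y) = R (R x * y + x * R y)

/-- The complementary map `id - R`. -/
def rbTilde (R : A →ₗ[K] A) : A →ₗ[K] A := LinearMap.id - R

/-- The product of the double of the Rota–Baxter algebra `(A, R)`. -/
def doubleMul (R : A →ₗ[K] A) (a b : A) : A := R a * b + a * R b - a * b

/-- The convolution product of maps into the double of `(A, R)`. -/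
def convDouble (R : A →ₗ[K] A) (f g : HRT K →ₗ[K] A) : HRT K →ₗ[K] A :=
  conv f (R ∘ₗ g) + conv (R ∘ₗ f) g - conv f g

/-- `convDoublePow R f n` is the `(n + 1)`-st convolution power of `f` as a map into the double. -/
def convDoublePow (R : A →ₗ[K] A) (f : HRT K →ₗ[K] A) : ℕ → (HRT K →ₗ[K] A)
  | 0 => f
  | n + 1 => convDouble R f (convDoublePow R f n)

/-- The exponential `∑ f^{⋆_R k} / k!` for the convolution product into the double, on the
augmentation ideal (for `f 1 = 0`, with the sum cut off as for `convExp`). The double has in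
general no unit; the term `k = 0`, a formal unit times the counit, vanishes on the augmentation
ideal and is left out. -/
def convDoubleExp (R : A →ₗ[K] A) (f : HRT K →ₗ[K] A) : HRT K →ₗ[K] A :=
  (MvPolynomial.basisMonomials RTree K).constr K fun s =>
    ∑ k ∈ Finset.range (forestDegree s),
      (((k + 1).factorial : K)⁻¹) • convDoublePow R f k (MvPolynomial.monomial s 1)

/-- Successive approximations to the solution of `χ = Z - BCH (R ∘ χ, (id - R) ∘ χ)`. -/
def chiApprox (R : A →ₗ[K] A) (Z : HRT K →ₗ[K] A) : ℕ → (HRT K →ₗ[K] A)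
  | 0 => Z
  | n + 1 => Z - BCH (R ∘ₗ chiApprox R Z n) (rbTilde R ∘ₗ chiApprox R Z n)

/-- The solution `χ(Z)` of `χ = Z - BCH (R ∘ χ, (id - R) ∘ χ)`: on forests with `m` vertices the
approximations are constant from the `m`-th on. -/
def chi (R : A →ₗ[K] A) (Z : HRT K →ₗ[K] A) : HRT K →ₗ[K] A :=
  (MvPolynomial.basisMonomials RTree K).constr K fun s =>
    chiApprox R Z (forestDegree s) (MvPolynomial.monomial s 1)

/-- The Bogoliubov character `b[φ]` of `φ = exp Z`, on the augmentation ideal. -/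
def bogoliubov (R : A →ₗ[K] A) (Z : HRT K →ₗ[K] A) : HRT K →ₗ[K] A :=
  convDoubleExp R (-chi R Z)

/-- The factor `φ₋ = exp (- R ∘ χ(Z))`. -/
def phiMinus (R : A →ₗ[K] A) (Z : HRT K →ₗ[K] A) : HRT K →ₗ[K] A :=
  convExp (-(R ∘ₗ chi R Z))

/-- The factor `φ₊ = exp ((id - R) ∘ χ(Z))`. -/
def phiPlus (R : A →ₗ[K] A) (Z : HRT K →ₗ[K] A) : HRT K →ₗ[K] A :=
  convExp (rbTilde R ∘ₗ chi R Z)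

/-- The mixed terms
`∑_{n=0}^{m} (1/n!) ∑_{j=1}^{n-1} (n choose j) (R(-χ(Z)))^{⋆(n-j)} ⋆ Z^{⋆j}`. -/
def mixedTerms (R : A →ₗ[K] A) (Z : HRT K →ₗ[K] A) (m : ℕ) : HRT K →ₗ[K] A :=
  ∑ n ∈ Finset.range (m + 1), ((n.factorial : K)⁻¹) •
    ∑ j ∈ Finset.Ico 1 n, (n.choose j : K) •
      conv (convPow (R ∘ₗ (-chi R Z)) (n - j)) (convPow Z j)

end Convolution

end

noncomputable section

/-! Everything happens in the convolution algebra of linear maps `HRT K →ₗ[K] A`, filtered by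
`convFil`: a map has order at least `n` if it vanishes on forests with fewer than `n` vertices. For
this, rooted trees must form a graded coalgebra. The grafting operator `B₊` is a cocycle for the cut
coproduct (`coproduct_bPlus`), and induction along `B₊` gives coassociativity and the counit laws.
The filtration is multiplicative and separated, so identities between `exp` and `log` of one element
reduce to congruences modulo `X ^ (n + 1)` in `K[X]`.

The Leibniz rule for powers shows that `exp` sends infinitesimal characters to characters; the
converse for `log` is an induction on degree. Without its linear part, the BCH series raises the
order of differences by one (`clog_mul_cexp_congr`), so the recursion for `χ` is a contraction and
has exactly one fixed point. Since `R` and `id - R` add up to the identity, the fixed point equation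
says `Z = log (exp (R ∘ χ) ⋆ exp ((id - R) ∘ χ))`, which is the Birkhoff decomposition.

The Rota–Baxter relation makes both `R` and `-(id - R)` multiplicative from the double to `A`. They
therefore carry `b[φ]` to `φ₋` and `φ₊` on the augmentation ideal, whence `b[φ] = φ₋ - φ₊` there. So
any formula `φ₊ x = φ₋ x + p` forces `φ₋ x = -R p` and `φ₊ x = (id - R) p`. The two explicit
formulae compute `p` from `φ₊ = φ₋ ⋆ φ`, by expanding the exponentials or the coproduct of a tree.
-/

theorem exists_equiv_of_map_univ_eq {α β γ : Type*} [Fintype α] [Fintype β] {f : α → γ}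
    {g : β → γ} (h : Finset.univ.val.map f = Finset.univ.val.map g) :
    ∃ σ : α ≃ β, ∀ i, g (σ i) = f i := by
  classical
  have e : ∀ c, {a // f a = c} ≃ {b // g b = c} := by
    intro c
    refine Fintype.equivOfCardEq ?_
    have := congrArg (Multiset.count c) h
    rw [Multiset.count_map, Multiset.count_map] at this
    rw [Fintype.card_subtype, Fintype.card_subtype]
    simpa [Finset.card_def, eq_comm] using this
  exact ⟨Equiv.ofFiberEquiv e, fun i => Equiv.ofFiberEquiv_map e i⟩

theorem map_univ_get {α : Type*} (m : Multiset α) :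
    (Finset.univ : Finset (Fin m.toList.length)).val.map (fun i => m.toList.get i) = m := by
  rw [Fin.univ_val_map, List.ofFn_get, Multiset.coe_toList]

/-! ### Admissible cuts and the branches at the root -/

namespace PTree

/-- The edges of a tree, sorted by the branches at the root. -/
def edgeEquiv {n : ℕ} (c : Fin n → PTree) :
    (Σ i : Fin n, Option (Edge (c i))) ≃ Edge (node n c) where
  toFun x := match x with
    | ⟨i, none⟩ => Edge.root i
    | ⟨i, some e⟩ => Edge.child i e
  invFun e := match e with
    | Edge.root i => ⟨i, none⟩
    | Edge.child i e => ⟨i, some e⟩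
  left_inv x := by rcases x with ⟨i, _ | e⟩ <;> rfl
  right_inv e := by cases e <;> rfl

theorem prod_edge {M : Type*} [CommMonoid M] {n : ℕ} (c : Fin n → PTree)
    (f : Edge (node n c) → M) :
    ∏ e, f e = ∏ i, (f (Edge.root i) * ∏ e, f (Edge.child i e)) := by
  rw [← (edgeEquiv c).prod_comp, Fintype.prod_sigma]
  refine Finset.prod_congr rfl fun i _ => ?_
  rw [Fintype.prod_option]
  rfl

open Classical in
/-- The set of edges of `node n c` given on each branch by either the edge at the root (`none`) or
a set of edges of the branch. -/
def joinCut {n : ℕ} {c : Fin n → PTree} (p : ∀ i, Option (Finset (Edge (c i)))) :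
    Finset (Edge (node n c)) :=
  Finset.univ.filter fun e => match e with
    | Edge.root i => p i = none
    | Edge.child i e => ∃ D, p i = some D ∧ e ∈ D

open Classical in
/-- The restriction of a set of edges to the branches. -/
def splitCut {n : ℕ} {c : Fin n → PTree} (C : Finset (Edge (node n c))) (i : Fin n) :
    Option (Finset (Edge (c i))) :=
  if Edge.root i ∈ C then none else some (Finset.univ.filter fun e => Edge.child i e ∈ C)

theorem root_mem_joinCut {n : ℕ} {c : Fin n → PTree} {p : ∀ i, Option (Finset (Edge (c i)))}
    {i : Fin n} : (Edge.root i : Edge (node n c)) ∈ joinCut p ↔ p i = none := by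
  simp [joinCut]

theorem child_mem_joinCut {n : ℕ} {c : Fin n → PTree} {p : ∀ i, Option (Finset (Edge (c i)))}
    {i : Fin n} {e : Edge (c i)} :
    (Edge.child i e : Edge (node n c)) ∈ joinCut p ↔ ∃ D, p i = some D ∧ e ∈ D := by
  simp [joinCut]

theorem OnPath.refl : ∀ {t : PTree} (e : Edge t), OnPath e e
  | _, Edge.root i => OnPath.root_root i
  | _, Edge.child i e => OnPath.child_child i (OnPath.refl e)

open Classical in
/-- The admissible cuts of a tree, including the empty one. -/
def admissibleCuts (t : PTree) : Finset (Finset (Edge t)) :=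
  Finset.univ.filter fun C => Admissible C

theorem mem_admissibleCuts {t : PTree} {C : Finset (Edge t)} :
    C ∈ admissibleCuts t ↔ Admissible C := by simp [admissibleCuts]

theorem admissible_empty {t : PTree} : Admissible (∅ : Finset (Edge t)) := by
  intro f e he; simp at he

theorem sum_admissibleCuts {M : Type*} [AddCommMonoid M] (t : PTree)
    (F : Finset (Edge t) → M) :
    ∑ C ∈ admissibleCuts t, F C = F ∅ + ∑ C ∈ cuts t, F C := by
  classical
  have h : admissibleCuts t = insert ∅ (cuts t) := by
    ext C
    rcases C.eq_empty_or_nonempty with rfl | hC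
    · simp [admissibleCuts, cuts, admissible_empty]
    · simp [admissibleCuts, cuts, hC, hC.ne_empty]
  rw [h, Finset.sum_insert]
  simp [cuts]

/-- A path from the root into a branch starts with the root edge of that branch. Hence a cut
containing this edge can contain no other edge of the branch, and different branches do not
interact. -/
theorem admissible_joinCut {n : ℕ} {c : Fin n → PTree}
    {p : ∀ i, Option (Finset (Edge (c i)))} :
    Admissible (joinCut p) ↔ ∀ i D, p i = some D → Admissible D := by
  constructor
  · intro h i D hD f e he e' he' h1 h2
    have := h (Edge.child i f) (Edge.child i e) (child_mem_joinCut.2 ⟨D, hD, he⟩)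
      (Edge.child i e') (child_mem_joinCut.2 ⟨D, hD, he'⟩)
      (OnPath.child_child i h1) (OnPath.child_child i h2)
    simpa using this
  · intro h f e he e' he' h1 h2
    cases h1 with
    | root_root i => cases h2; rfl
    | root_child i f =>
      cases h2 with
      | root_child => rfl
      | child_child _ h2 =>
        rw [root_mem_joinCut] at he
        obtain ⟨D, hD, -⟩ := child_mem_joinCut.1 he'
        simp [he] at hD
    | child_child i h1 =>
      obtain ⟨D, hD, hm⟩ := child_mem_joinCut.1 he
      cases h2 with
      | root_child =>
        rw [root_mem_joinCut] at he'
        simp [he'] at hD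
      | child_child _ h2 =>
        obtain ⟨D', hD', hm'⟩ := child_mem_joinCut.1 he'
        obtain rfl : D = D' := by simpa [hD] using hD'
        rw [h i D hD _ _ hm _ hm' h1 h2]

theorem joinCut_splitCut {n : ℕ} {c : Fin n → PTree} {C : Finset (Edge (node n c))}
    (hC : Admissible C) : joinCut (splitCut C) = C := by
  ext e
  cases e with
  | root i => rw [root_mem_joinCut]; simp [splitCut]
  | child i e =>
    rw [child_mem_joinCut]
    by_cases h : (Edge.root i : Edge (node n c)) ∈ C
    · simp only [splitCut, h, if_true, reduceCtorEq, false_and, exists_false, false_iff]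
      intro he
      have := hC _ _ h _ he (OnPath.root_child i e) (OnPath.refl _)
      simp at this
    · simp [splitCut, h]

theorem splitCut_joinCut {n : ℕ} {c : Fin n → PTree}
    (p : ∀ i, Option (Finset (Edge (c i)))) : splitCut (joinCut p) = p := by
  funext i
  cases h : p i with
  | none => simp [splitCut, root_mem_joinCut, h]
  | some D =>
    rw [splitCut, if_neg (by simp [root_mem_joinCut, h])]
    congr 1
    ext e
    simp [child_mem_joinCut, h]

/-- Independently for each branch, an admissible cut either removes it whole (`none`) or cuts it
admissibly, possibly trivially (`some D`). This product structure makes the coproduct of a tree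
computable from its branches. -/
theorem sum_admissibleCuts_node {M : Type*} [AddCommMonoid M] {n : ℕ} (c : Fin n → PTree)
    (F : Finset (Edge (node n c)) → M) :
    ∑ C ∈ admissibleCuts (node n c), F C =
      ∑ p ∈ Fintype.piFinset fun i => (admissibleCuts (c i)).insertNone, F (joinCut p) := by
  refine Finset.sum_nbij' splitCut joinCut ?_ ?_ ?_ ?_ ?_
  · intro C hC
    rw [mem_admissibleCuts] at hC
    rw [Fintype.mem_piFinset]
    intro i
    rw [Finset.mem_insertNone]
    intro D hD
    rw [mem_admissibleCuts]
    refine admissible_joinCut.1 ?_ i D hD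
    rwa [joinCut_splitCut hC]
  · intro p hp
    rw [mem_admissibleCuts, admissible_joinCut]
    intro i D hD
    rw [Fintype.mem_piFinset] at hp
    exact mem_admissibleCuts.1 (Finset.mem_insertNone.1 (hp i) D hD)
  · exact fun C hC => joinCut_splitCut (mem_admissibleCuts.1 hC)
  · exact fun p _ => splitCut_joinCut p
  · intro C hC
    rw [joinCut_splitCut (mem_admissibleCuts.1 hC)]

end PTree

namespace RTree

theorem mk_rep (T : RTree) : mk T.rep = T := Quotient.out_eq T

theorem mk_eq_mk {s t : PTree} : mk s = mk t ↔ PTree.Iso s t := Quotient.eq (r := PTree.isoSetoid)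

/-- `graft` orders the branches and chooses their representatives arbitrarily; equal multisets of
classes differ by a bijection of the indices, which is exactly an isomorphism at the root. -/
theorem mk_node {n : ℕ} (c : Fin n → PTree) :
    mk (PTree.node n c) = graft (Finset.univ.val.map fun i => mk (c i)) := by
  obtain ⟨σ, hσ⟩ := exists_equiv_of_map_univ_eq
    (map_univ_get (Finset.univ.val.map fun i => mk (c i))).symm
  rw [graft, mk_eq_mk]
  refine PTree.Iso.node σ fun i => ?_
  rw [← mk_eq_mk, mk_rep, hσ]

theorem size_mk (t : PTree) : (mk t).size = t.size := rfl

theorem size_graft (m : Multiset RTree) : (graft m).size = 1 + (m.map size).sum := by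
  rw [graft, size_mk, PTree.size]
  conv_rhs => rw [← map_univ_get m, Multiset.map_map]
  congr 1
  refine Finset.sum_congr rfl fun i _ => ?_
  rw [← size_mk, mk_rep]
  rfl

theorem size_pos (T : RTree) : 0 < T.size := by
  rw [← mk_rep T, size_mk]
  cases T.rep
  simp [PTree.size]

end RTree

/-! ### The coalgebra of rooted trees and the grafting operator -/

section RootedTreeCoalgebra

open MvPolynomial hiding counit

variable (K : Type*) [Field K]

/-- The operator `B₊` which grafts the trees of a forest to a new root. -/
def bPlus : HRT K →ₗ[K] HRT K :=
  (basisMonomials RTree K).constr K fun s => X (RTree.graft (Finsupp.toMultiset s))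

theorem bPlus_monomial (s : RTree →₀ ℕ) :
    bPlus K (monomial s 1) = X (RTree.graft (Finsupp.toMultiset s)) := by
  have := (basisMonomials RTree K).constr_basis K
    (fun s => (X (RTree.graft (Finsupp.toMultiset s)) : HRT K)) s
  rwa [coe_basisMonomials] at this

theorem monomial_eq_prod_toMultiset (s : RTree →₀ ℕ) :
    (monomial s 1 : HRT K) = ((Finsupp.toMultiset s).map X).prod := by
  rw [monomial_eq, map_one, one_mul, Finsupp.toMultiset_map, Finsupp.prod_toMultiset,
    Finsupp.prod_mapDomain_index (by simp) (by intros; rw [pow_add])]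

theorem bPlus_prod (m : Multiset RTree) : bPlus K (m.map X).prod = X (RTree.graft m) := by
  classical
  have := bPlus_monomial K (Multiset.toFinsupp m)
  rwa [monomial_eq_prod_toMultiset, Multiset.toFinsupp_toMultiset] at this

theorem hrt_hom_ext {M : Type*} [AddCommMonoid M] [Module K M] {f g : HRT K →ₗ[K] M}
    (h : ∀ s : RTree →₀ ℕ, f (monomial s 1) = g (monomial s 1)) : f = g := by
  refine (basisMonomials RTree K).ext fun s => ?_
  simpa only [coe_basisMonomials] using h s

/-- The sum `∑ P_C ⊗ R_C` over the admissible cuts including the empty one. -/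
def cutSum (t : PTree) : HRT K ⊗[K] HRT K :=
  ∑ C ∈ t.admissibleCuts, prunedPart K C ⊗ₜ[K] rootPart K C

theorem prune_empty : ∀ t : PTree, t.prune ∅ = RTree.mk t
  | PTree.node n c => by
    have h : ∀ i, (c i).prune ∅ = RTree.mk (c i) := fun i => prune_empty (c i)
    rw [PTree.prune, RTree.mk_node]
    congr 1
    simp [h]

theorem cutSum_eq (t : PTree) :
    cutSum K t = 1 ⊗ₜ[K] treeEl K t + ∑ C ∈ t.cuts, prunedPart K C ⊗ₜ[K] rootPart K C := by
  rw [cutSum, PTree.sum_admissibleCuts]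
  simp [prunedPart, rootPart, prune_empty, treeEl]

theorem tmul_prod {ι : Type*} (s : Finset ι) (a b : ι → HRT K) :
    ∏ i ∈ s, a i ⊗ₜ[K] b i = (∏ i ∈ s, a i) ⊗ₜ[K] ∏ i ∈ s, b i := by
  classical
  induction s using Finset.induction_on with
  | empty => rfl
  | insert i s hi ih => simp [Finset.prod_insert hi, ih]

theorem prunedPart_joinCut {n : ℕ} {c : Fin n → PTree}
    (p : ∀ i, Option (Finset (PTree.Edge (c i)))) :
    prunedPart K (PTree.joinCut p) = ∏ i, (p i).elim (treeEl K (c i)) (prunedPart K) := by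
  classical
  rw [prunedPart, ← Fintype.prod_ite_mem, PTree.prod_edge]
  refine Finset.prod_congr rfl fun i _ => ?_
  cases h : p i with
  | none => simp [PTree.root_mem_joinCut, PTree.child_mem_joinCut, h, PTree.branch]
  | some D =>
    simp only [PTree.root_mem_joinCut, PTree.child_mem_joinCut, h, PTree.branch, prunedPart,
      Option.elim, ← Fintype.prod_ite_mem D]
    simp

theorem rootPart_joinCut {n : ℕ} {c : Fin n → PTree}
    (p : ∀ i, Option (Finset (PTree.Edge (c i)))) :
    rootPart K (PTree.joinCut p) = bPlus K (∏ i, (p i).elim 1 (rootPart K)) := by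
  classical
  rw [rootPart, PTree.prune, ← bPlus_prod, Multiset.map_map]
  congr 1
  rw [← Finset.prod_filter_mul_prod_filter_not Finset.univ
    fun i => (PTree.Edge.root i : PTree.Edge (PTree.node n c)) ∉ PTree.joinCut p]
  have h1 : ∏ i with ¬(PTree.Edge.root i : PTree.Edge (PTree.node n c)) ∉ PTree.joinCut p,
      (p i).elim (1 : HRT K) (rootPart K) = 1 := by
    refine Finset.prod_eq_one fun i hi => ?_
    rw [Finset.mem_filter, not_not, PTree.root_mem_joinCut] at hi
    rw [hi.2]
    rfl
  rw [h1, mul_one]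
  refine Finset.prod_congr (by simp) fun i hi => ?_
  obtain ⟨D, hD⟩ : ∃ D, p i = some D := by
    rw [Finset.mem_filter, PTree.root_mem_joinCut] at hi
    exact Option.ne_none_iff_exists'.1 hi.2
  simp only [Function.comp, hD, Option.elim, rootPart]
  congr 2
  ext e
  simp [PTree.child_mem_joinCut, hD]

/-- The coproduct of a tree, computed on a plane representative. -/
def treeCoproduct (t : PTree) : HRT K ⊗[K] HRT K := treeEl K t ⊗ₜ[K] 1 + cutSum K t

/-- The additional index `none` stands for the full cut, which contributes `T ⊗ 1`. It matches the
`none` of `joinCut`. -/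
theorem treeCoproduct_eq_sum (t : PTree) :
    treeCoproduct K t = ∑ p ∈ t.admissibleCuts.insertNone,
      p.elim (treeEl K t) (prunedPart K) ⊗ₜ[K] p.elim 1 (rootPart K) := by
  rw [Finset.sum_insertNone]
  rfl

/-- Expanding the product over the branches gives one term for each choice of full, empty or proper
cut on every branch, that is for each admissible cut of the tree. This is the cocycle property of
`B₊` on plane representatives. -/
theorem cutSum_node {n : ℕ} (c : Fin n → PTree) :
    cutSum K (PTree.node n c) = (bPlus K).lTensor (HRT K) (∏ i, treeCoproduct K (c i)) := by
  simp only [treeCoproduct_eq_sum]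
  rw [Finset.prod_univ_sum, map_sum, cutSum, PTree.sum_admissibleCuts_node]
  refine Finset.sum_congr rfl fun p _ => ?_
  rw [tmul_prod, LinearMap.lTensor_tmul, prunedPart_joinCut, rootPart_joinCut]

/-- The formula of `cutSum_node` is a commutative product over the branches, so it is insensitive to
their order. This makes the choice of `T.rep` in `coproduct` harmless. -/
theorem treeCoproduct_congr {s t : PTree} (h : PTree.Iso s t) :
    treeCoproduct K s = treeCoproduct K t := by
  induction h with
  | @node n m c d σ h ih =>
    rw [treeCoproduct, treeCoproduct, cutSum_node, cutSum_node]
    congr 2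
    · rw [treeEl, treeEl, RTree.mk_eq_mk.2 (PTree.Iso.node σ h)]
    · exact Fintype.prod_equiv σ _ _ ih

theorem coproduct_treeEl (t : PTree) : coproduct K (treeEl K t) = treeCoproduct K t := by
  have h : treeCoproduct K t = treeCoproduct K (RTree.mk t).rep :=
    treeCoproduct_congr K (RTree.mk_eq_mk.1 (RTree.mk_rep _).symm)
  rw [h, treeCoproduct, cutSum_eq, treeEl, treeEl, RTree.mk_rep, coproduct, aeval_X, add_assoc]

theorem coproduct_treeEl_eq (t : PTree) :
    coproduct K (treeEl K t) = treeEl K t ⊗ₜ[K] 1 + 1 ⊗ₜ[K] treeEl K t +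
      ∑ C ∈ t.cuts, prunedPart K C ⊗ₜ[K] rootPart K C := by
  rw [coproduct_treeEl, treeCoproduct, cutSum_eq, add_assoc]

theorem treeEl_node {n : ℕ} (c : Fin n → PTree) :
    treeEl K (PTree.node n c) = bPlus K (∏ i, treeEl K (c i)) := by
  rw [treeEl, RTree.mk_node, ← bPlus_prod, Multiset.map_map]
  rfl

theorem coproduct_bPlus_prod {n : ℕ} (c : Fin n → PTree) :
    coproduct K (bPlus K (∏ i, treeEl K (c i))) = bPlus K (∏ i, treeEl K (c i)) ⊗ₜ[K] 1 +
      (bPlus K).lTensor (HRT K) (coproduct K (∏ i, treeEl K (c i))) := by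
  rw [← treeEl_node, coproduct_treeEl, treeCoproduct, cutSum_node, map_prod (coproduct K)]
  simp only [coproduct_treeEl]

theorem exists_monomial_eq_prod (s : RTree →₀ ℕ) : ∃ (n : ℕ) (c : Fin n → PTree),
    (monomial s 1 : HRT K) = ∏ i, treeEl K (c i) := by
  refine ⟨_, fun i => ((Finsupp.toMultiset s).toList.get i).rep, ?_⟩
  rw [monomial_eq_prod_toMultiset]
  conv_lhs => rw [← map_univ_get (Finsupp.toMultiset s), Multiset.map_map]
  refine Finset.prod_congr rfl fun i _ => ?_
  rw [treeEl, RTree.mk_rep]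
  rfl

/-- `B₊` is a cocycle for the coproduct. -/
theorem coproduct_bPlus (x : HRT K) :
    coproduct K (bPlus K x) = bPlus K x ⊗ₜ[K] 1 + (bPlus K).lTensor (HRT K) (coproduct K x) := by
  have h : (coproduct K).toLinearMap ∘ₗ bPlus K =
      (TensorProduct.mk K (HRT K) (HRT K)).flip 1 ∘ₗ bPlus K +
        (bPlus K).lTensor (HRT K) ∘ₗ (coproduct K).toLinearMap := by
    refine hrt_hom_ext K fun s => ?_
    obtain ⟨n, c, hs⟩ := exists_monomial_eq_prod K s
    rw [hs]
    exact coproduct_bPlus_prod K c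
  exact LinearMap.congr_fun h x

/-- Algebra morphisms on rooted trees agree if they do so on `B₊ x` whenever they do on `x`. -/
theorem algHom_ext_of_bPlus {B : Type*} [CommRing B] [Algebra K B] {f g : HRT K →ₐ[K] B}
    (h : ∀ x, f x = g x → f (bPlus K x) = g (bPlus K x)) : f = g := by
  have key : ∀ t : PTree, f (treeEl K t) = g (treeEl K t) := by
    intro t
    induction t with
    | node n c ih =>
      rw [treeEl_node]
      refine h _ ?_
      rw [map_prod, map_prod]
      exact Finset.prod_congr rfl fun i _ => ih i
  refine MvPolynomial.algHom_ext fun T => ?_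
  have := key T.rep
  rwa [treeEl, RTree.mk_rep] at this

theorem counit_bPlus (x : HRT K) : counit K (bPlus K x) = 0 := by
  have h : (counit K).toLinearMap ∘ₗ bPlus K = 0 := by
    refine hrt_hom_ext K fun s => ?_
    simp [bPlus_monomial, counit]
  exact LinearMap.congr_fun h x

/-- Both sides are algebra morphisms, so it suffices to pass from `x` to `B₊ x`. Applying the
cocycle identity twice, each side becomes `B₊ x ⊗ 1 ⊗ 1 + (id ⊗ B₊) Δ x ⊗ 1` plus `id ⊗ id ⊗ B₊`
applied to the corresponding side for `x`. -/
theorem coproduct_coassoc (x : HRT K) :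
    TensorProduct.assoc K (HRT K) (HRT K) (HRT K)
        ((coproduct K).toLinearMap.rTensor (HRT K) (coproduct K x)) =
      (coproduct K).toLinearMap.lTensor (HRT K) (coproduct K x) := by
  have h : ((AlgEquiv.toAlgHom (Algebra.TensorProduct.assoc K K K (HRT K) (HRT K) (HRT K))).comp
      (Algebra.TensorProduct.map (coproduct K) (AlgHom.id K (HRT K)))).comp (coproduct K) =
      (Algebra.TensorProduct.map (AlgHom.id K (HRT K)) (coproduct K)).comp (coproduct K) := by
    refine algHom_ext_of_bPlus K (B := HRT K ⊗[K] (HRT K ⊗[K] HRT K)) fun x hx => ?_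
    have h1 : ∀ z : HRT K ⊗[K] HRT K,
        TensorProduct.assoc K (HRT K) (HRT K) (HRT K)
          ((coproduct K).toLinearMap.rTensor (HRT K) ((bPlus K).lTensor (HRT K) z)) =
        ((bPlus K).lTensor (HRT K)).lTensor (HRT K)
          (TensorProduct.assoc K (HRT K) (HRT K) (HRT K)
            ((coproduct K).toLinearMap.rTensor (HRT K) z)) := by
      intro z
      induction z with
      | zero => simp
      | add a b ha hb => simp only [map_add, ha, hb]
      | tmul a b =>
        simp only [LinearMap.lTensor_tmul, LinearMap.rTensor_tmul]
        generalize (coproduct K).toLinearMap a = w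
        induction w with
        | zero => simp
        | add a b ha hb => simp only [TensorProduct.add_tmul, map_add, ha, hb]
        | tmul u v => simp
    have h2 : ∀ z : HRT K ⊗[K] HRT K,
        (coproduct K).toLinearMap.lTensor (HRT K) ((bPlus K).lTensor (HRT K) z) =
          TensorProduct.assoc K (HRT K) (HRT K) (HRT K)
            ((bPlus K).lTensor (HRT K) z ⊗ₜ[K] 1) +
          ((bPlus K).lTensor (HRT K)).lTensor (HRT K)
            ((coproduct K).toLinearMap.lTensor (HRT K) z) := by
      intro z
      induction z with
      | zero => simp
      | add a b ha hb =>
        simp only [map_add, TensorProduct.add_tmul, ha, hb]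
        abel
      | tmul a b =>
        simp [coproduct_bPlus, TensorProduct.tmul_add]
    change TensorProduct.assoc K (HRT K) (HRT K) (HRT K)
        ((coproduct K).toLinearMap.rTensor (HRT K) (coproduct K x)) =
      (coproduct K).toLinearMap.lTensor (HRT K) (coproduct K x) at hx
    change TensorProduct.assoc K (HRT K) (HRT K) (HRT K)
        ((coproduct K).toLinearMap.rTensor (HRT K) (coproduct K (bPlus K x))) =
      (coproduct K).toLinearMap.lTensor (HRT K) (coproduct K (bPlus K x))
    rw [coproduct_bPlus, map_add, map_add, map_add, h1, hx, h2, ← add_assoc]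
    congr 1
    simp [coproduct_bPlus, TensorProduct.add_tmul, Algebra.TensorProduct.one_def]
  exact DFunLike.congr_fun h x

theorem rTensor_counit_coproduct (x : HRT K) :
    (counit K).toLinearMap.rTensor (HRT K) (coproduct K x) = 1 ⊗ₜ[K] x := by
  have h : (Algebra.TensorProduct.map (counit K) (AlgHom.id K (HRT K))).comp (coproduct K) =
      Algebra.TensorProduct.includeRight := by
    refine algHom_ext_of_bPlus K fun x hx => ?_
    have h1 : ∀ z : HRT K ⊗[K] HRT K,
        (counit K).toLinearMap.rTensor (HRT K) ((bPlus K).lTensor (HRT K) z) =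
        (bPlus K).lTensor K ((counit K).toLinearMap.rTensor (HRT K) z) := by
      intro z
      induction z with
      | zero => simp
      | add a b ha hb => simp only [map_add, ha, hb]
      | tmul a b => simp
    change (counit K).toLinearMap.rTensor (HRT K) (coproduct K x) = 1 ⊗ₜ[K] x at hx
    change (counit K).toLinearMap.rTensor (HRT K) (coproduct K (bPlus K x)) = 1 ⊗ₜ[K] bPlus K x
    rw [coproduct_bPlus, map_add, h1, hx]
    simp [counit_bPlus]
  exact DFunLike.congr_fun h x

theorem lTensor_counit_coproduct (x : HRT K) :
    (counit K).toLinearMap.lTensor (HRT K) (coproduct K x) = x ⊗ₜ[K] 1 := by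
  have h : (Algebra.TensorProduct.map (AlgHom.id K (HRT K)) (counit K)).comp (coproduct K) =
      Algebra.TensorProduct.includeLeft := by
    refine algHom_ext_of_bPlus K fun x _ => ?_
    have h1 : ∀ z : HRT K ⊗[K] HRT K,
        (counit K).toLinearMap.lTensor (HRT K) ((bPlus K).lTensor (HRT K) z) = 0 := by
      intro z
      induction z with
      | zero => simp
      | add a b ha hb => simp only [map_add, ha, hb, add_zero]
      | tmul a b => simp [counit_bPlus]
    change (counit K).toLinearMap.lTensor (HRT K) (coproduct K (bPlus K x)) = bPlus K x ⊗ₜ[K] 1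
    rw [coproduct_bPlus, map_add, h1]
    simp
  exact DFunLike.congr_fun h x

/-- The coalgebra of rooted trees with the coproduct given by admissible cuts. -/
instance rootedTreeCoalgebra : Coalgebra K (HRT K) where
  comul := (coproduct K).toLinearMap
  counit := (counit K).toLinearMap
  coassoc := LinearMap.ext (coproduct_coassoc K)
  rTensor_counit_comp_comul := LinearMap.ext (rTensor_counit_coproduct K)
  lTensor_counit_comp_comul := LinearMap.ext (lTensor_counit_coproduct K)

/-! ### The grading by the number of vertices -/

theorem forestDegree_add (s t : RTree →₀ ℕ) :
    forestDegree (s + t) = forestDegree s + forestDegree t := by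
  classical
  rw [forestDegree, Finsupp.sum_add_index' (by simp) (by intros; rw [add_mul])]
  rfl

theorem forestDegree_zero : forestDegree 0 = 0 := rfl

theorem forestDegree_single (T : RTree) : forestDegree (Finsupp.single T 1) = T.size := by
  rw [forestDegree, Finsupp.sum_single_index (by simp), one_mul]

theorem forestDegree_eq_sum (s : RTree →₀ ℕ) :
    forestDegree s = ((Finsupp.toMultiset s).map RTree.size).sum := by
  induction s using Finsupp.induction_linear with
  | zero => rfl
  | add s t hs ht => rw [forestDegree_add, hs, ht, map_add, Multiset.map_add, Multiset.sum_add]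
  | single T k =>
    rw [forestDegree, Finsupp.sum_single_index (by simp), Finsupp.toMultiset_single,
      Multiset.map_nsmul, Multiset.sum_nsmul]
    simp

/-- The span of the elements `a ⊗ b` with forests `a`, `b` having `n` vertices together. -/
def tensorDegree (n : ℕ) : Submodule K (HRT K ⊗[K] HRT K) :=
  Submodule.span K {z | ∃ a b : RTree →₀ ℕ, forestDegree a + forestDegree b = n ∧
    z = monomial a 1 ⊗ₜ[K] monomial b 1}

theorem mul_mem_tensorDegree {m n : ℕ} {x y : HRT K ⊗[K] HRT K} (hx : x ∈ tensorDegree K m)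
    (hy : y ∈ tensorDegree K n) : x * y ∈ tensorDegree K (m + n) := by
  have h : tensorDegree K m * tensorDegree K n ≤ tensorDegree K (m + n) := by
    rw [tensorDegree, tensorDegree, Submodule.span_mul_span, Submodule.span_le]
    rintro _ ⟨_, ⟨a, b, h, rfl⟩, _, ⟨a', b', h', rfl⟩, rfl⟩
    refine Submodule.subset_span ⟨a + a', b + b', ?_, ?_⟩
    · rw [forestDegree_add, forestDegree_add]; omega
    · simp [monomial_mul]
  exact h (Submodule.mul_mem_mul hx hy)

theorem one_mem_tensorDegree : (1 : HRT K ⊗[K] HRT K) ∈ tensorDegree K 0 :=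
  Submodule.subset_span ⟨0, 0, rfl, rfl⟩

theorem prod_mem_tensorDegree {n : ℕ} {x : Fin n → HRT K ⊗[K] HRT K} {d : Fin n → ℕ}
    (h : ∀ i, x i ∈ tensorDegree K (d i)) : ∏ i, x i ∈ tensorDegree K (∑ i, d i) := by
  induction n with
  | zero => simpa using one_mem_tensorDegree K
  | succ n ih =>
    rw [Fin.prod_univ_succ, Fin.sum_univ_succ]
    exact mul_mem_tensorDegree K (h 0) (ih fun i => h i.succ)

theorem bPlus_mem_tensorDegree {n : ℕ} {x : HRT K ⊗[K] HRT K} (hx : x ∈ tensorDegree K n) :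
    (bPlus K).lTensor (HRT K) x ∈ tensorDegree K (1 + n) := by
  have h : tensorDegree K n ≤ (tensorDegree K (1 + n)).comap ((bPlus K).lTensor (HRT K)) := by
    rw [tensorDegree, Submodule.span_le]
    rintro _ ⟨a, b, h, rfl⟩
    refine Submodule.subset_span ⟨a, Finsupp.single (RTree.graft (Finsupp.toMultiset b)) 1, ?_, ?_⟩
    · rw [forestDegree_single, RTree.size_graft, ← forestDegree_eq_sum]; omega
    · rw [LinearMap.lTensor_tmul, bPlus_monomial]; rfl
  exact h hx

theorem treeCoproduct_mem : ∀ t : PTree, treeCoproduct K t ∈ tensorDegree K t.size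
  | PTree.node n c => by
    rw [treeCoproduct, cutSum_node]
    refine Submodule.add_mem _ ?_ ?_
    · refine Submodule.subset_span ⟨Finsupp.single (RTree.mk (PTree.node n c)) 1, 0, ?_, rfl⟩
      rw [forestDegree_single, forestDegree_zero, RTree.size_mk, add_zero]
    · exact bPlus_mem_tensorDegree K (prod_mem_tensorDegree K fun i => treeCoproduct_mem (c i))

theorem coproduct_mem (s : RTree →₀ ℕ) :
    coproduct K (monomial s 1) ∈ tensorDegree K (forestDegree s) := by
  rw [monomial_eq_prod_toMultiset, forestDegree_eq_sum]
  induction Finsupp.toMultiset s using Multiset.induction_on with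
  | empty => simpa using one_mem_tensorDegree K
  | cons T m ih =>
    rw [Multiset.map_cons, Multiset.map_cons, Multiset.sum_cons, Multiset.prod_cons, map_mul]
    refine mul_mem_tensorDegree K ?_ ih
    have := treeCoproduct_mem K T.rep
    rwa [← coproduct_treeEl, treeEl, ← RTree.size_mk, RTree.mk_rep] at this

end RootedTreeCoalgebra

/-! ### Truncated exponential and logarithm as polynomials -/

section TruncatedSeries

open Polynomial

variable (K : Type*) [Field K]

/-- The exponential series up to order `n`. -/
def expPoly (n : ℕ) : K[X] := ∑ k ∈ Finset.range (n + 1), C ((k.factorial : K)⁻¹) * X ^ k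

/-- The series of `log (1 + X)` up to order `n`. -/
def logPoly (n : ℕ) : K[X] := ∑ k ∈ Finset.Icc 1 n, C ((-1 : K) ^ (k - 1) * (k : K)⁻¹) * X ^ k

theorem expPoly_succ (n : ℕ) :
    expPoly K (n + 1) = expPoly K n + C (((n + 1).factorial : K)⁻¹) * X ^ (n + 1) :=
  Finset.sum_range_succ _ _

theorem logPoly_succ (n : ℕ) :
    logPoly K (n + 1) = logPoly K n + C ((-1 : K) ^ n * ((n + 1 : ℕ) : K)⁻¹) * X ^ (n + 1) := by
  rw [logPoly, Finset.sum_Icc_succ_top (by omega)]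
  rfl

theorem eval_expPoly_zero (n : ℕ) : (expPoly K n).eval 0 = 1 := by
  induction n with
  | zero => simp [expPoly]
  | succ n ih => rw [expPoly_succ]; simp [ih]

theorem eval_logPoly_zero (n : ℕ) : (logPoly K n).eval 0 = 0 := by
  induction n with
  | zero => simp [logPoly]
  | succ n ih => rw [logPoly_succ]; simp [ih]

variable {K} in
theorem X_pow_dvd_comp {n : ℕ} {p q : K[X]} (h : X ^ n ∣ p) (hq : X ∣ q) : X ^ n ∣ p.comp q := by
  obtain ⟨r, rfl⟩ := h
  rw [mul_comp, X_pow_comp]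
  exact (pow_dvd_pow_of_dvd hq n).mul_right _

variable {K} in
theorem X_dvd_expPoly_sub_one (n : ℕ) : (X : K[X]) ∣ expPoly K n - 1 := by
  rw [X_dvd_iff, coeff_zero_eq_eval_zero]
  simp [eval_expPoly_zero]

variable {K} in
theorem X_dvd_logPoly (n : ℕ) : (X : K[X]) ∣ logPoly K n := by
  rw [X_dvd_iff, coeff_zero_eq_eval_zero, eval_logPoly_zero]

variable [CharZero K]

theorem derivative_expPoly_succ (n : ℕ) :
    derivative (expPoly K (n + 1)) = expPoly K n := by
  induction n with
  | zero => simp [expPoly, Finset.sum_range_succ]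
  | succ n ih =>
    rw [expPoly_succ, derivative_add, ih, expPoly_succ, derivative_C_mul_X_pow]
    congr 3
    rw [Nat.factorial_succ (n + 1)]
    have h1 : ((n + 1 + 1 : ℕ) : K) ≠ 0 := Nat.cast_ne_zero.2 (by omega)
    have h2 : ((n + 1).factorial : K) ≠ 0 := Nat.cast_ne_zero.2 (Nat.factorial_ne_zero _)
    push_cast at *
    field_simp

/-- The derivative is a finite geometric sum in `-X`, which telescopes. -/
theorem derivative_logPoly_mul (n : ℕ) :
    derivative (logPoly K n) * (1 + X) = 1 - (-X) ^ n := by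
  induction n with
  | zero => simp [logPoly]
  | succ n ih =>
    have h1 : ((n + 1 : ℕ) : K) ≠ 0 := Nat.cast_ne_zero.2 (by omega)
    rw [logPoly_succ, derivative_add, add_mul, ih, derivative_C_mul_X_pow, mul_assoc,
      mul_assoc, inv_mul_cancel₀ h1, mul_one, C_pow, C_neg, C_1, Nat.add_sub_cancel,
      neg_pow (X : K[X]) n, neg_pow (X : K[X]) (n + 1)]
    ring

variable {K}

theorem X_pow_dvd_of_derivative {n : ℕ} {p : K[X]} (h0 : p.eval 0 = 0)
    (h : X ^ n ∣ derivative p) : X ^ (n + 1) ∣ p := by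
  rw [X_pow_dvd_iff] at h ⊢
  intro d hd
  rcases d with _ | d
  · rwa [coeff_zero_eq_eval_zero]
  · have := h d (by omega)
    rw [coeff_derivative] at this
    have h1 : (d : K) + 1 ≠ 0 := Nat.cast_add_one_ne_zero d
    simpa [h1] using this

theorem X_pow_dvd_expPoly_sub_derivative (n : ℕ) :
    X ^ n ∣ expPoly K n - derivative (expPoly K n) := by
  cases n with
  | zero => simp
  | succ n =>
    rw [derivative_expPoly_succ, expPoly_succ, add_sub_cancel_left]
    exact dvd_mul_left _ _

/-- The truncated exponential differs from its derivative only by its top term, so the product has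
derivative zero modulo `X ^ n`; its value at `0` is `1`. -/
theorem exp_neg_mul_exp (n : ℕ) :
    X ^ (n + 1) ∣ (expPoly K n).comp (-X) * expPoly K n - 1 := by
  refine X_pow_dvd_of_derivative (by simp [eval_expPoly_zero]) ?_
  have h1 := X_pow_dvd_expPoly_sub_derivative (K := K) n
  have h2 := X_pow_dvd_comp h1 (q := -X) (by simp)
  have : derivative ((expPoly K n).comp (-X) * expPoly K n - 1) =
      (expPoly K n - derivative (expPoly K n)).comp (-X) * expPoly K n -
        (expPoly K n).comp (-X) * (expPoly K n - derivative (expPoly K n)) := by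
    simp only [derivative_sub, derivative_mul, derivative_comp, sub_comp, derivative_neg,
      derivative_X, derivative_one]
    ring
  rw [this]
  exact dvd_sub (h2.mul_right _) (h1.mul_left _)

/-- With `E` the truncated exponential, `L'(E - 1) * E = 1` and `E' = E` modulo `X ^ n`, so the
derivative of the difference vanishes after multiplication by `E`. As `E` has constant term `1`, it
is coprime to `X ^ n` and can be cancelled. -/
theorem log_comp_exp (n : ℕ) :
    X ^ (n + 1) ∣ (logPoly K n).comp (expPoly K n - 1) - X := by
  refine X_pow_dvd_of_derivative (by simp [eval_expPoly_zero, eval_logPoly_zero]) ?_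
  have h1 := X_pow_dvd_expPoly_sub_derivative (K := K) n
  have h2 := congrArg (fun p => p.comp (expPoly K n - 1)) (derivative_logPoly_mul K n)
  simp only [mul_comp, add_comp, one_comp, X_comp, sub_comp, pow_comp, neg_comp,
    add_sub_cancel] at h2
  have h3 : IsCoprime (X ^ n : K[X]) (expPoly K n) := by
    refine IsCoprime.pow_left ?_
    obtain ⟨r, hr⟩ := X_dvd_expPoly_sub_one (K := K) n
    exact ⟨-r, 1, by linear_combination hr⟩
  refine h3.dvd_of_dvd_mul_right ?_
  set E := expPoly K n
  have h4 : X ^ n ∣ (-(E - 1)) ^ n :=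
    pow_dvd_pow_of_dvd ((X_dvd_expPoly_sub_one (K := K) n).neg_right) n
  have : derivative ((logPoly K n).comp (E - 1) - X) * E =
      -(E - derivative E) - derivative E * (-(E - 1)) ^ n := by
    simp only [derivative_sub, derivative_comp, derivative_one, derivative_X]
    linear_combination derivative E * h2
  rw [this]
  exact dvd_sub h1.neg_right (h4.mul_left _)

/-- The composite `F` satisfies `F = (1 + X) * F'` modulo `X ^ n`, with `F(0) = 1`. Hence `F'(0) =
1` once `n` is positive, and differentiating again gives `(1 + X) * F'' = 0` modulo `X ^ (n - 1)`.
Two integrations yield the claim. -/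
theorem exp_comp_log (n : ℕ) :
    X ^ (n + 1) ∣ (expPoly K n).comp (logPoly K n) - (1 + X) := by
  set L := logPoly K n
  set F := (expPoly K n).comp L with hF
  have h0 : F.eval 0 = 1 := by simp [hF, L, eval_comp, eval_logPoly_zero, eval_expPoly_zero]
  have h1 : X ^ n ∣ F - (1 + X) * derivative F := by
    have h := X_pow_dvd_comp (X_pow_dvd_expPoly_sub_derivative (K := K) n)
      (X_dvd_logPoly (K := K) n)
    have : F - (1 + X) * derivative F =
        (expPoly K n - derivative (expPoly K n)).comp L +
          (derivative (expPoly K n)).comp L * (-X) ^ n := by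
      simp only [hF, derivative_comp, sub_comp]
      linear_combination (-(derivative (expPoly K n)).comp L) * derivative_logPoly_mul K n
    rw [this]
    refine dvd_add h ((pow_dvd_pow_of_dvd (by simp) n).mul_left _)
  refine X_pow_dvd_of_derivative (by simp [h0]) ?_
  cases n with
  | zero => simp
  | succ n =>
    refine X_pow_dvd_of_derivative ?_ ?_
    · have h := dvd_trans (dvd_pow_self X (Nat.succ_ne_zero n)) h1
      rw [X_dvd_iff, coeff_zero_eq_eval_zero] at h
      simp [h0] at h
      simp [← sub_eq_zero.1 h]
    · have h3 : IsCoprime (X ^ n : K[X]) (1 + X) :=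
        IsCoprime.pow_left ⟨-1, 1, by ring⟩
      refine h3.dvd_of_dvd_mul_right ?_
      have h4 : X ^ n ∣ derivative (F - (1 + X) * derivative F) := by
        obtain ⟨r, hr⟩ := h1
        rw [hr, derivative_mul, derivative_X_pow, Nat.add_sub_cancel]
        exact dvd_add ((dvd_mul_left _ _).mul_right _)
          ((pow_dvd_pow X (Nat.le_succ n)).mul_right _)
      have : derivative (derivative (F - (1 + X))) * (1 + X) =
          -derivative (F - (1 + X) * derivative F) := by
        simp only [derivative_sub, derivative_mul, derivative_add, derivative_one, derivative_X,
          derivative_zero]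
        ring
      rw [this]
      exact h4.neg_right

end TruncatedSeries

/-! ### The filtered convolution algebra, its exponential and logarithm -/

section ConvolutionAlgebra

open MvPolynomial hiding counit

variable (K A : Type*) [Field K] [CommRing A] [Algebra K A]

/-- The algebra of linear maps from the coalgebra of rooted trees, with the convolution product. -/
abbrev ConvAlg : Type _ := WithConv (HRT K →ₗ[K] A)

/-- The maps which vanish on forests with less than `n` vertices. -/
def convFil (n : ℕ) : Submodule K (ConvAlg K A) where
  carrier := {f | ∀ s, forestDegree s < n → f.ofConv (monomial s 1) = 0}
  add_mem' {f g} hf hg s hs := by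
    rw [WithConv.ofConv_add, LinearMap.add_apply, hf s hs, hg s hs, add_zero]
  zero_mem' s hs := rfl
  smul_mem' c f hf s hs := by
    rw [WithConv.ofConv_smul, LinearMap.smul_apply, hf s hs, smul_zero]

variable {K A}

theorem mem_convFil {n : ℕ} {f : ConvAlg K A} :
    f ∈ convFil K A n ↔ ∀ s, forestDegree s < n → f.ofConv (monomial s 1) = 0 := Iff.rfl

theorem convFil_anti {m n : ℕ} (h : m ≤ n) : convFil K A n ≤ convFil K A m :=
  fun _ hf s hs => hf s (hs.trans_le h)

theorem mem_convFil_zero (f : ConvAlg K A) : f ∈ convFil K A 0 := fun s hs => by omega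

theorem forestDegree_eq_zero {s : RTree →₀ ℕ} (h : forestDegree s = 0) : s = 0 := by
  rw [forestDegree, Finsupp.sum, Finset.sum_eq_zero_iff] at h
  ext T
  by_contra hT
  have := h T (Finsupp.mem_support_iff.2 hT)
  have := T.size_pos
  simp_all

theorem mem_convFil_one {f : ConvAlg K A} : f ∈ convFil K A 1 ↔ f.ofConv 1 = 0 := by
  constructor
  · intro h
    exact h 0 (by simp [forestDegree_zero])
  · intro h s hs
    rw [forestDegree_eq_zero (s := s) (by omega)]
    exact h

/-- The filtration is separated: identities need only be checked to every finite order, where all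
series become polynomials. -/
theorem eq_of_sub_mem_convFil {f g : ConvAlg K A} (h : ∀ n, f - g ∈ convFil K A n) : f = g := by
  refine WithConv.ext (hrt_hom_ext K fun s => ?_)
  exact sub_eq_zero.1 (h _ s (Nat.lt_succ_self _))

/-- The coproduct preserves the total degree, so if `a` and `b` together have fewer than `m + n`
vertices, then `a` has fewer than `m` or `b` fewer than `n`. -/
theorem mul_mem_convFil {m n : ℕ} {f g : ConvAlg K A} (hf : f ∈ convFil K A m)
    (hg : g ∈ convFil K A n) : f * g ∈ convFil K A (m + n) := by
  intro s hs
  have key : tensorDegree K (forestDegree s) ≤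
      LinearMap.ker (LinearMap.mul' K A ∘ₗ TensorProduct.map f.ofConv g.ofConv) := by
    rw [tensorDegree, Submodule.span_le]
    rintro _ ⟨a, b, h, rfl⟩
    have h1 : f.ofConv (monomial a 1) = 0 ∨ g.ofConv (monomial b 1) = 0 := by
      rcases lt_or_ge (forestDegree a) m with ha | ha
      · exact Or.inl (hf a ha)
      · exact Or.inr (hg b (by omega))
    rcases h1 with h1 | h1 <;> simp [h1]
  exact key (coproduct_mem K s)

theorem mul_mem_convFil_left {n : ℕ} (f : ConvAlg K A) {g : ConvAlg K A}
    (hg : g ∈ convFil K A n) : f * g ∈ convFil K A n := by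
  simpa using mul_mem_convFil (mem_convFil_zero f) hg

theorem mul_mem_convFil_right {n : ℕ} {f : ConvAlg K A} (g : ConvAlg K A)
    (hf : f ∈ convFil K A n) : f * g ∈ convFil K A n := by
  simpa using mul_mem_convFil hf (mem_convFil_zero g)

theorem pow_mem_convFil {f : ConvAlg K A} (hf : f ∈ convFil K A 1) (n : ℕ) :
    f ^ n ∈ convFil K A n := by
  induction n with
  | zero => exact mem_convFil_zero _
  | succ n ih => rw [pow_succ]; exact mul_mem_convFil ih hf

theorem mul_sub_mul_mem_convFil {n : ℕ} {f f' g g' : ConvAlg K A}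
    (hf : f - f' ∈ convFil K A n) (hg : g - g' ∈ convFil K A n) :
    f * g - f' * g' ∈ convFil K A n := by
  have : f * g - f' * g' = (f - f') * g + f' * (g - g') := by noncomm_ring
  rw [this]
  exact add_mem (mul_mem_convFil_right _ hf) (mul_mem_convFil_left _ hg)

theorem aeval_mem_convFil {f : ConvAlg K A} (hf : f ∈ convFil K A 1) {n : ℕ}
    {p : Polynomial K} (hp : Polynomial.X ^ n ∣ p) : Polynomial.aeval f p ∈ convFil K A n := by
  obtain ⟨q, rfl⟩ := hp
  rw [map_mul, map_pow, Polynomial.aeval_X]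
  exact mul_mem_convFil_right _ (pow_mem_convFil hf n)

/-- Polynomials are continuous for the filtration. -/
theorem aeval_sub_mem_convFil {n : ℕ} {f g : ConvAlg K A} (h : f - g ∈ convFil K A n)
    (p : Polynomial K) : Polynomial.aeval f p - Polynomial.aeval g p ∈ convFil K A n := by
  induction p using Polynomial.induction_on' with
  | add p q hp hq =>
    have := add_mem hp hq
    rwa [map_add, map_add, add_sub_add_comm]
  | monomial k c =>
    rw [Polynomial.aeval_monomial, Polynomial.aeval_monomial]
    refine mul_sub_mul_mem_convFil (by simp) ?_
    induction k with
    | zero => simp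
    | succ k ih => rw [pow_succ, pow_succ]; exact mul_sub_mul_mem_convFil ih h

/-- The linear part of a polynomial dominates differences. -/
theorem aeval_sub_smul_mem_convFil {n : ℕ} {f g : ConvAlg K A} (hf : f ∈ convFil K A 1)
    (hg : g ∈ convFil K A 1) (h : f - g ∈ convFil K A n) (p : Polynomial K) :
    Polynomial.aeval f p - Polynomial.aeval g p - p.coeff 1 • (f - g) ∈ convFil K A (n + 1) := by
  induction p using Polynomial.induction_on' with
  | add p q hp hq =>
    have := add_mem hp hq
    convert this using 1
    rw [map_add, map_add, Polynomial.coeff_add, add_smul]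
    abel
  | monomial k c =>
    simp only [Polynomial.aeval_monomial, Polynomial.coeff_monomial, ← Algebra.smul_def]
    rcases k with _ | _ | k
    · simp
    · simp [smul_sub]
    · rw [if_neg (by omega), zero_smul, sub_zero, ← smul_sub]
      refine Submodule.smul_mem _ _ ?_
      have h1 : f ^ (k + 1) - g ^ (k + 1) ∈ convFil K A n := by
        simpa using aeval_sub_mem_convFil h (Polynomial.X ^ (k + 1))
      have : f ^ (k + 1 + 1) - g ^ (k + 1 + 1) =
          (f ^ (k + 1) - g ^ (k + 1)) * f + g ^ (k + 1) * (f - g) := by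
        rw [pow_succ f (k + 1), pow_succ g (k + 1)]; noncomm_ring
      rw [this]
      refine add_mem (mul_mem_convFil h1 hf) ?_
      rw [add_comm n]
      refine mul_mem_convFil ?_ h
      exact convFil_anti (by omega) (pow_mem_convFil hg (k + 1))

theorem toConv_convPow (f : HRT K →ₗ[K] A) (n : ℕ) :
    WithConv.toConv (convPow f n) = WithConv.toConv f ^ n := by
  induction n with
  | zero => rfl
  | succ n ih => rw [pow_succ', ← ih]; rfl

theorem constr_monomial {M : Type*} [AddCommMonoid M] [Module K M] (F : (RTree →₀ ℕ) → M)
    (s : RTree →₀ ℕ) : (basisMonomials RTree K).constr K F (monomial s 1) = F s := by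
  have := (basisMonomials RTree K).constr_basis K F s
  rwa [coe_basisMonomials] at this

/-- The convolution exponential. -/
def cexp (f : ConvAlg K A) : ConvAlg K A := WithConv.toConv (convExp f.ofConv)

/-- The convolution logarithm. -/
def clog (f : ConvAlg K A) : ConvAlg K A := WithConv.toConv (convLog f.ofConv)

/-- `convExp` truncates at a different order for each forest. Since `f ^ k` vanishes on forests with
fewer than `k` vertices, one polynomial serves for all forests with at most `n` vertices. -/
theorem cexp_sub_mem {f : ConvAlg K A} (hf : f ∈ convFil K A 1) (n : ℕ) :
    cexp f - Polynomial.aeval f (expPoly K n) ∈ convFil K A (n + 1) := by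
  intro s hs
  rw [WithConv.ofConv_sub, LinearMap.sub_apply, sub_eq_zero, cexp, WithConv.ofConv_toConv,
    convExp, constr_monomial, expPoly, map_sum, WithConv.ofConv_sum, LinearMap.sum_apply]
  have h : ∀ k : ℕ, (Polynomial.aeval f (Polynomial.C ((k.factorial : K)⁻¹) *
      Polynomial.X ^ k)).ofConv (monomial s 1) =
      ((k.factorial : K)⁻¹) • convPow f.ofConv k (monomial s 1) := by
    intro k
    rw [map_mul, map_pow, Polynomial.aeval_X, Polynomial.aeval_C, ← Algebra.smul_def,
      WithConv.ofConv_smul, LinearMap.smul_apply]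
    exact congrArg (fun g : ConvAlg K A => _ • g.ofConv (monomial s 1))
      (toConv_convPow f.ofConv k).symm
  simp only [h]
  refine Finset.sum_subset (by simpa using hs) fun k _ hk => ?_
  rw [Finset.mem_range] at hk
  rw [← WithConv.ofConv_toConv (convPow _ _), toConv_convPow]
  rw [pow_mem_convFil (f := WithConv.toConv f.ofConv) hf k s (by omega), smul_zero]

theorem clog_sub_mem {f : ConvAlg K A} (hf : f - 1 ∈ convFil K A 1) (n : ℕ) :
    clog f - Polynomial.aeval (f - 1) (logPoly K n) ∈ convFil K A (n + 1) := by
  intro s hs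
  rw [WithConv.ofConv_sub, LinearMap.sub_apply, sub_eq_zero, clog, WithConv.ofConv_toConv,
    convLog, constr_monomial, logPoly, map_sum, WithConv.ofConv_sum, LinearMap.sum_apply]
  have h : ∀ k : ℕ, (Polynomial.aeval (f - 1) (Polynomial.C ((-1 : K) ^ (k - 1) * (k : K)⁻¹) *
      Polynomial.X ^ k)).ofConv (monomial s 1) =
      ((-1 : K) ^ (k - 1) * (k : K)⁻¹) • convPow (f.ofConv - convOne K A) k (monomial s 1) := by
    intro k
    rw [map_mul, map_pow, Polynomial.aeval_X, Polynomial.aeval_C, ← Algebra.smul_def,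
      WithConv.ofConv_smul, LinearMap.smul_apply]
    exact congrArg (fun g : ConvAlg K A => _ • g.ofConv (monomial s 1))
      (toConv_convPow (f.ofConv - convOne K A) k).symm
  simp only [h]
  refine Finset.sum_subset (Finset.Icc_subset_Icc le_rfl (by omega)) fun k hk hk' => ?_
  rw [Finset.mem_Icc] at hk hk'
  rw [← WithConv.ofConv_toConv (convPow _ _), toConv_convPow]
  rw [pow_mem_convFil (f := WithConv.toConv (f.ofConv - convOne K A)) hf k s (by omega), smul_zero]

theorem coeff_one_expPoly (n : ℕ) : (expPoly K (n + 1)).coeff 1 = 1 := by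
  simp [expPoly, Polynomial.coeff_X_pow]

theorem coeff_one_logPoly (n : ℕ) : (logPoly K (n + 1)).coeff 1 = 1 := by
  simp only [logPoly, Polynomial.finsetSum_coeff, Polynomial.coeff_C_mul, Polynomial.coeff_X_pow]
  simp

theorem cexp_sub_one_mem {f : ConvAlg K A} (hf : f ∈ convFil K A 1) :
    cexp f - 1 ∈ convFil K A 1 := by
  have := cexp_sub_mem hf 0
  simpa [expPoly] using this

theorem clog_mem {f : ConvAlg K A} (hf : f - 1 ∈ convFil K A 1) : clog f ∈ convFil K A 1 := by
  have := clog_sub_mem hf 0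
  simpa [logPoly] using this

theorem cexp_congr {n : ℕ} {f g : ConvAlg K A} (hf : f ∈ convFil K A 1)
    (hg : g ∈ convFil K A 1) (h : f - g ∈ convFil K A n) :
    cexp f - cexp g - (f - g) ∈ convFil K A (n + 1) := by
  have h1 := aeval_sub_smul_mem_convFil hf hg h (expPoly K (n + 1))
  have h2 := convFil_anti (Nat.le_succ _) (cexp_sub_mem hf (n + 1))
  have h3 := convFil_anti (Nat.le_succ _) (cexp_sub_mem hg (n + 1))
  convert add_mem (sub_mem h2 h3) h1 using 1
  rw [coeff_one_expPoly, one_smul]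
  abel

theorem clog_congr {n : ℕ} {f g : ConvAlg K A} (hf : f - 1 ∈ convFil K A 1)
    (hg : g - 1 ∈ convFil K A 1) (h : f - g ∈ convFil K A n) :
    clog f - clog g - (f - g) ∈ convFil K A (n + 1) := by
  have h1 := aeval_sub_smul_mem_convFil hf hg (by simpa using h) (logPoly K (n + 1))
  have h2 := convFil_anti (Nat.le_succ _) (clog_sub_mem hf (n + 1))
  have h3 := convFil_anti (Nat.le_succ _) (clog_sub_mem hg (n + 1))
  convert add_mem (sub_mem h2 h3) h1 using 1
  rw [coeff_one_logPoly, one_smul]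
  abel

theorem mul_sub_one_mem {f g : ConvAlg K A} (hf : f - 1 ∈ convFil K A 1)
    (hg : g - 1 ∈ convFil K A 1) : f * g - 1 ∈ convFil K A 1 := by
  simpa using mul_sub_mul_mem_convFil hf hg

/-- To first order `exp`, `log` and the product of elements near `1` act linearly on differences;
every further term contains another factor of positive order. So the nonlinear part of BCH gains one
degree, which makes the recursion for `χ` contract. -/
theorem clog_mul_cexp_congr {n : ℕ} {a a' b b' : ConvAlg K A} (ha : a ∈ convFil K A 1)
    (ha' : a' ∈ convFil K A 1) (hb : b ∈ convFil K A 1) (hb' : b' ∈ convFil K A 1)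
    (h : a - a' ∈ convFil K A n) (h' : b - b' ∈ convFil K A n) :
    clog (cexp a * cexp b) - clog (cexp a' * cexp b') - (a - a') - (b - b') ∈
      convFil K A (n + 1) := by
  have h1 := cexp_congr ha ha' h
  have h2 := cexp_congr hb hb' h'
  have e1 : cexp a - cexp a' ∈ convFil K A n := by
    simpa using add_mem (convFil_anti (Nat.le_succ _) h1) h
  have e2 : cexp b - cexp b' ∈ convFil K A n := by
    simpa using add_mem (convFil_anti (Nat.le_succ _) h2) h'
  have h3 : cexp a * cexp b - cexp a' * cexp b' - (cexp a - cexp a') - (cexp b - cexp b') ∈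
      convFil K A (n + 1) := by
    have : cexp a * cexp b - cexp a' * cexp b' - (cexp a - cexp a') - (cexp b - cexp b') =
        (cexp a - cexp a') * (cexp b - 1) + (cexp a' - 1) * (cexp b - cexp b') := by noncomm_ring
    rw [this]
    refine add_mem (mul_mem_convFil e1 (cexp_sub_one_mem hb)) ?_
    rw [add_comm n]
    exact mul_mem_convFil (cexp_sub_one_mem ha') e2
  have h4 := clog_congr (mul_sub_one_mem (cexp_sub_one_mem ha) (cexp_sub_one_mem hb))
    (mul_sub_one_mem (cexp_sub_one_mem ha') (cexp_sub_one_mem hb'))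
    (mul_sub_mul_mem_convFil e1 e2)
  convert add_mem (add_mem h4 h3) (add_mem h1 h2) using 1
  abel

variable [CharZero K]

/-- Only powers of the single element `f` occur, so the identity is the image of a congruence in
`K[X]` under evaluation at `f`. -/
theorem clog_cexp {f : ConvAlg K A} (hf : f ∈ convFil K A 1) : clog (cexp f) = f := by
  refine eq_of_sub_mem_convFil fun n => convFil_anti (Nat.le_succ n) ?_
  have h1 := clog_sub_mem (cexp_sub_one_mem hf) n
  have h2 := aeval_sub_mem_convFil (f := cexp f - 1)
    (g := Polynomial.aeval f (expPoly K n) - 1) (by simpa using cexp_sub_mem hf n) (logPoly K n)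
  have h3 := aeval_mem_convFil hf (log_comp_exp (K := K) n)
  rw [map_sub, Polynomial.aeval_comp, map_sub, map_one, Polynomial.aeval_X] at h3
  convert add_mem (add_mem h1 h2) h3 using 1
  abel

theorem cexp_clog {f : ConvAlg K A} (hf : f - 1 ∈ convFil K A 1) : cexp (clog f) = f := by
  refine eq_of_sub_mem_convFil fun n => convFil_anti (Nat.le_succ n) ?_
  have h1 := cexp_sub_mem (clog_mem hf) n
  have h2 := aeval_sub_mem_convFil (clog_sub_mem hf n) (expPoly K n)
  have h3 := aeval_mem_convFil hf (exp_comp_log (K := K) n)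
  rw [map_sub, Polynomial.aeval_comp, map_add, map_one, Polynomial.aeval_X] at h3
  convert add_mem (add_mem h1 h2) h3 using 1
  abel

theorem cexp_neg_mul_cexp {f : ConvAlg K A} (hf : f ∈ convFil K A 1) :
    cexp (-f) * cexp f = 1 := by
  refine eq_of_sub_mem_convFil fun n => convFil_anti (Nat.le_succ n) ?_
  have h1 := mul_sub_mul_mem_convFil (cexp_sub_mem (neg_mem hf) n) (cexp_sub_mem hf n)
  have h3 := aeval_mem_convFil hf (exp_neg_mul_exp (K := K) n)
  rw [map_sub, map_mul, Polynomial.aeval_comp, map_one, map_neg, Polynomial.aeval_X] at h3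
  convert add_mem h1 h3 using 1
  abel

theorem cexp_mul_cexp_neg {f : ConvAlg K A} (hf : f ∈ convFil K A 1) :
    cexp f * cexp (-f) = 1 := by
  simpa using cexp_neg_mul_cexp (neg_mem hf)

end ConvolutionAlgebra

/-! ### Characters and infinitesimal characters -/

section Characters

open MvPolynomial hiding counit

variable {K A : Type*} [Field K] [CommRing A] [Algebra K A]

theorem convAlg_one_apply (x : HRT K) :
    (1 : ConvAlg K A).ofConv x = algebraMap K A (counit K x) := rfl

theorem counit_monomial_of_ne_zero {s : RTree →₀ ℕ} (hs : s ≠ 0) :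
    counit K (monomial s 1) = 0 := by
  obtain ⟨T, hT⟩ := Finsupp.support_nonempty_iff.2 hs
  rw [counit, aeval_monomial, Finsupp.prod, Finset.prod_eq_zero hT, mul_zero]
  exact zero_pow (Finsupp.mem_support_iff.1 hT)

theorem IsInfinitesimalCharacter.apply_one {Z : HRT K →ₗ[K] A}
    (hZ : IsInfinitesimalCharacter Z) : Z 1 = 0 := by
  have := hZ 1 1
  simpa using this

theorem IsInfinitesimalCharacter.mem_convFil {Z : HRT K →ₗ[K] A}
    (hZ : IsInfinitesimalCharacter Z) : WithConv.toConv Z ∈ convFil K A 1 :=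
  mem_convFil_one.2 hZ.apply_one

theorem IsInfinitesimalCharacter.comp {Z : HRT K →ₗ[K] A} (hZ : IsInfinitesimalCharacter Z)
    (N : A →ₗ[K] A) : IsInfinitesimalCharacter (N ∘ₗ Z) := by
  intro x y
  simp [hZ x y]

theorem IsInfinitesimalCharacter.sub {Z Z' : HRT K →ₗ[K] A} (hZ : IsInfinitesimalCharacter Z)
    (hZ' : IsInfinitesimalCharacter Z') : IsInfinitesimalCharacter (Z - Z') := by
  intro x y
  simp only [LinearMap.sub_apply, hZ x y, hZ' x y, smul_sub]
  abel

theorem IsInfinitesimalCharacter.neg {Z : HRT K →ₗ[K] A} (hZ : IsInfinitesimalCharacter Z) :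
    IsInfinitesimalCharacter (-Z) := by
  intro x y
  simp only [LinearMap.neg_apply, hZ x y, smul_neg]
  abel

theorem IsCharacter.sub_one_mem {φ : HRT K →ₗ[K] A} (hφ : IsCharacter φ) :
    WithConv.toConv φ - 1 ∈ convFil K A 1 := by
  rw [mem_convFil_one, WithConv.ofConv_sub, LinearMap.sub_apply, convAlg_one_apply]
  simp [hφ.1]

/-- Bilinear maps which agree on forests are equal. -/
theorem hrt_bilin_ext {M : Type*} [AddCommMonoid M] [Module K M]
    {B B' : HRT K →ₗ[K] HRT K →ₗ[K] M}
    (h : ∀ s t : RTree →₀ ℕ, B (monomial s 1) (monomial t 1) = B' (monomial s 1) (monomial t 1)) :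
    B = B' :=
  hrt_hom_ext K fun s => hrt_hom_ext K fun t => h s t

theorem isCharacter_of_monomial {φ : HRT K →ₗ[K] A} (h1 : φ 1 = 1)
    (h : ∀ s t : RTree →₀ ℕ,
      φ (monomial s 1 * monomial t 1) = φ (monomial s 1) * φ (monomial t 1)) :
    IsCharacter φ := by
  refine ⟨h1, fun x y => ?_⟩
  have : (LinearMap.mul K (HRT K)).compr₂ φ = (LinearMap.mul K A).compl₁₂ φ φ :=
    hrt_bilin_ext h
  exact LinearMap.congr_fun₂ this x y

theorem isInfinitesimalCharacter_of_monomial {Z : HRT K →ₗ[K] A}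
    (h : ∀ s t : RTree →₀ ℕ, Z (monomial s 1 * monomial t 1) =
      counit K (monomial t 1) • Z (monomial s 1) + counit K (monomial s 1) • Z (monomial t 1)) :
    IsInfinitesimalCharacter Z := by
  intro x y
  have : (LinearMap.mul K (HRT K)).compr₂ Z =
      (LinearMap.lsmul K A).flip.compl₁₂ Z (counit K).toLinearMap +
        (LinearMap.lsmul K A).compl₁₂ (counit K).toLinearMap Z :=
    hrt_bilin_ext h
  exact LinearMap.congr_fun₂ this x y

theorem IsCharacter.conv {φ ψ : HRT K →ₗ[K] A} (hφ : IsCharacter φ) (hψ : IsCharacter ψ) :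
    IsCharacter (conv φ ψ) := by
  have key : ∀ z w : HRT K ⊗[K] HRT K,
      LinearMap.mul' K A (TensorProduct.map φ ψ (z * w)) =
        LinearMap.mul' K A (TensorProduct.map φ ψ z) *
          LinearMap.mul' K A (TensorProduct.map φ ψ w) := by
    intro z w
    induction z with
    | zero => simp
    | add a b ha hb => simp only [add_mul, map_add, ha, hb]
    | tmul a b =>
      induction w with
      | zero => simp
      | add c d hc hd => simp only [mul_add, map_add, hc, hd]
      | tmul c d => simp [hφ.2, hψ.2, mul_mul_mul_comm]
  refine ⟨?_, fun x y => ?_⟩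
  · simp [_root_.conv, Algebra.TensorProduct.one_def, hφ.1, hψ.1]
  · have := key (coproduct K x) (coproduct K y)
    rwa [← map_mul] at this

/-- The convolution product with an infinitesimal character acts as a derivation. -/
theorem IsInfinitesimalCharacter.mul_apply_mul {Z : HRT K →ₗ[K] A}
    (hZ : IsInfinitesimalCharacter Z) {ι : Type*} {S : Finset ι} {g : ConvAlg K A}
    {u v : ι → ConvAlg K A}
    (hg : ∀ x y, g.ofConv (x * y) = ∑ p ∈ S, (u p).ofConv x * (v p).ofConv y) (x y : HRT K) :
    (WithConv.toConv Z * g).ofConv (x * y) =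
      ∑ p ∈ S, ((WithConv.toConv Z * u p).ofConv x * (v p).ofConv y +
        (u p).ofConv x * (WithConv.toConv Z * v p).ofConv y) := by
  -- The undifferentiated factors are written as convolutions with the unit, so that both sides are
  -- bilinear in `z` and `w` and can be compared on pure tensors.
  have key : ∀ z w : HRT K ⊗[K] HRT K,
      LinearMap.mul' K A (TensorProduct.map Z g.ofConv (z * w)) =
        ∑ p ∈ S, (LinearMap.mul' K A (TensorProduct.map Z (u p).ofConv z) *
          LinearMap.mul' K A (TensorProduct.map (convOne K A) (v p).ofConv w) +
          LinearMap.mul' K A (TensorProduct.map (convOne K A) (u p).ofConv z) *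
          LinearMap.mul' K A (TensorProduct.map Z (v p).ofConv w)) := by
    intro z w
    induction z with
    | zero => simp
    | add a b ha hb =>
      simp only [add_mul, map_add, ha, hb, ← Finset.sum_add_distrib]
      exact Finset.sum_congr rfl fun p _ => by ring
    | tmul a b =>
      induction w with
      | zero => simp
      | add c d hc hd =>
        simp only [mul_add, map_add, hc, hd, ← Finset.sum_add_distrib]
        exact Finset.sum_congr rfl fun p _ => by ring
      | tmul c d =>
        simp only [Algebra.TensorProduct.tmul_mul_tmul, TensorProduct.map_tmul,
          LinearMap.mul'_apply, hZ a c, hg, Finset.mul_sum]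
        refine Finset.sum_congr rfl fun p _ => ?_
        simp only [convOne, LinearMap.comp_apply, Algebra.linearMap_apply, AlgHom.toLinearMap_apply,
          Algebra.smul_def]
        ring
  have h1 : ∀ (f : ConvAlg K A) (x : HRT K), LinearMap.mul' K A
      (TensorProduct.map (convOne K A) f.ofConv (coproduct K x)) = f.ofConv x := by
    intro f x
    exact congrArg (fun f : ConvAlg K A => f.ofConv x) (one_mul f)
  have := key (coproduct K x) (coproduct K y)
  rw [← map_mul] at this
  simp only [h1] at this
  exact this

/-- The Leibniz rule for iterated derivations, by Pascal's rule. -/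
theorem IsInfinitesimalCharacter.pow_apply_mul {Z : HRT K →ₗ[K] A}
    (hZ : IsInfinitesimalCharacter Z) (n : ℕ) (x y : HRT K) :
    (WithConv.toConv Z ^ n).ofConv (x * y) = ∑ p ∈ Finset.HasAntidiagonal.antidiagonal n,
      (n.choose p.1 : K) •
        ((WithConv.toConv Z ^ p.1).ofConv x * (WithConv.toConv Z ^ p.2).ofConv y) := by
  induction n generalizing x y with
  | zero =>
    rw [Finset.HasAntidiagonal.antidiagonal_zero, Finset.sum_singleton]
    simp only [pow_zero, convAlg_one_apply, map_mul, Nat.choose_self, Nat.cast_one, one_smul]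
  | succ n ih =>
    have h := hZ.mul_apply_mul (S := Finset.HasAntidiagonal.antidiagonal n)
      (g := WithConv.toConv Z ^ n)
      (u := fun p => (n.choose p.1 : K) • WithConv.toConv Z ^ p.1)
      (v := fun p => WithConv.toConv Z ^ p.2) (fun x y => by rw [ih]; simp) x y
    rw [pow_succ', h, Finset.sum_add_distrib]
    have h2 := Finset.sum_antidiagonal_choose_succ_nsmul (fun i j =>
      (WithConv.toConv Z ^ i).ofConv x * (WithConv.toConv Z ^ j).ofConv y) n
    simp only [← Nat.cast_smul_eq_nsmul K] at h2
    rw [h2, add_comm]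
    congr 1
    · refine Finset.sum_congr rfl fun p _ => ?_
      rw [pow_succ', WithConv.ofConv_smul, LinearMap.smul_apply,
        smul_mul_assoc]
    · refine Finset.sum_congr rfl fun p hp => ?_
      rw [mul_smul_comm, ← pow_succ', Nat.choose_symm_of_eq_add 
        (Finset.HasAntidiagonal.mem_antidiagonal.1 hp).symm, 
        WithConv.ofConv_smul, LinearMap.smul_apply, smul_mul_assoc]

theorem sum_antidiagonal_eq_sum_sum {M : Type*} [AddCommMonoid M] (f : ℕ → ℕ → M) (m : ℕ)
    (h : ∀ i j, m ≤ i + j → f i j = 0) :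
    ∑ n ∈ Finset.range m, ∑ p ∈ Finset.HasAntidiagonal.antidiagonal n, f p.1 p.2 =
      ∑ i ∈ Finset.range m, ∑ j ∈ Finset.range m, f i j := by
  simp only [Finset.Nat.sum_antidiagonal_eq_sum_range_succ f]
  rw [Finset.sum_range_diag_flip]
  refine Finset.sum_congr rfl fun i _ => ?_
  refine Finset.sum_subset (by simp) fun j _ hj => h i j ?_
  rw [Finset.mem_range] at hj
  omega

theorem cexp_apply {f : ConvAlg K A} (hf : f ∈ convFil K A 1) {s : RTree →₀ ℕ} {m : ℕ}
    (hs : forestDegree s ≤ m) : (cexp f).ofConv (monomial s 1) =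
      ∑ n ∈ Finset.range (m + 1), ((n.factorial : K)⁻¹) • (f ^ n).ofConv (monomial s 1) := by
  have := cexp_sub_mem hf m s (by omega)
  rw [WithConv.ofConv_sub, LinearMap.sub_apply, sub_eq_zero] at this
  rw [this, expPoly, map_sum, WithConv.ofConv_sum, LinearMap.sum_apply]
  simp [← Algebra.smul_def]

theorem cexp_apply_one {f : ConvAlg K A} (hf : f ∈ convFil K A 1) : (cexp f).ofConv 1 = 1 := by
  have := mem_convFil_one.1 (cexp_sub_one_mem hf)
  rw [WithConv.ofConv_sub, LinearMap.sub_apply, sub_eq_zero, convAlg_one_apply] at this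
  simpa using this

theorem inv_factorial_mul_choose [CharZero K] (i j : ℕ) :
    (((i + j).factorial : K)⁻¹) * ((i + j).choose i : K) =
      ((i.factorial : K)⁻¹) * ((j.factorial : K)⁻¹) := by
  have h := Nat.add_choose_mul_factorial_mul_factorial i j
  rw [← Nat.choose_symm_add] at h
  have h' : ((i + j).choose i : K) * i.factorial * j.factorial = (i + j).factorial := by
    exact_mod_cast h
  have h1 : (i.factorial : K) ≠ 0 := Nat.cast_ne_zero.2 (Nat.factorial_ne_zero _)
  have h2 : (j.factorial : K) ≠ 0 := Nat.cast_ne_zero.2 (Nat.factorial_ne_zero _)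
  have h3 : ((i + j).factorial : K) ≠ 0 := Nat.cast_ne_zero.2 (Nat.factorial_ne_zero _)
  field_simp
  linear_combination h'

theorem IsInfinitesimalCharacter.isCharacter_convExp [CharZero K] {Z : HRT K →ₗ[K] A}
    (hZ : IsInfinitesimalCharacter Z) : IsCharacter (convExp Z) := by
  refine isCharacter_of_monomial (cexp_apply_one hZ.mem_convFil) fun s t => ?_
  change (cexp (WithConv.toConv Z)).ofConv _ = (cexp (WithConv.toConv Z)).ofConv _ *
    (cexp (WithConv.toConv Z)).ofConv _
  have hst : (monomial s 1 * monomial t 1 : HRT K) = monomial (s + t) 1 := by simp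
  -- A common truncation order for the three exponentials. The product of sums runs over a square of
  -- indices, the Leibniz formula over a triangle; terms with `i + j > m` vanish because `i` or `j`
  -- exceeds the degree of its forest.
  set m := forestDegree s + forestDegree t
  rw [hst, cexp_apply hZ.mem_convFil (forestDegree_add s t).le,
    cexp_apply hZ.mem_convFil (show forestDegree s ≤ m by omega),
    cexp_apply hZ.mem_convFil (show forestDegree t ≤ m by omega), Finset.sum_mul_sum,
    ← sum_antidiagonal_eq_sum_sum]
  · refine Finset.sum_congr rfl fun n _ => ?_
    rw [← hst, hZ.pow_apply_mul, Finset.smul_sum]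
    refine Finset.sum_congr rfl fun p hp => ?_
    rw [← Finset.HasAntidiagonal.mem_antidiagonal.1 hp, smul_smul, inv_factorial_mul_choose,
      smul_mul_smul_comm]
  · intro i j hij
    have h : forestDegree s < i ∨ forestDegree t < j := by omega
    rcases h with h | h
    · rw [pow_mem_convFil hZ.mem_convFil i s h, smul_zero, zero_mul]
    · rw [pow_mem_convFil hZ.mem_convFil j t h, smul_zero, mul_zero]

/-- Characters which agree on the trees with less than `n` vertices agree on the forests with less
than `n` vertices. -/
theorem IsCharacter.sub_mem_convFil {φ ψ : HRT K →ₗ[K] A} (hφ : IsCharacter φ)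
    (hψ : IsCharacter ψ) {n : ℕ} (h : ∀ T : RTree, T.size < n → φ (X T) = ψ (X T)) :
    WithConv.toConv φ - WithConv.toConv ψ ∈ convFil K A n := by
  intro s hs
  rw [WithConv.ofConv_sub, LinearMap.sub_apply, sub_eq_zero]
  change φ _ = ψ _
  rw [forestDegree_eq_sum] at hs
  rw [monomial_eq_prod_toMultiset]
  generalize Finsupp.toMultiset s = m at hs
  induction m using Multiset.induction_on with
  | empty => simp [hφ.1, hψ.1]
  | cons T m ih =>
    rw [Multiset.map_cons, Multiset.sum_cons] at hs
    rw [Multiset.map_cons, Multiset.prod_cons, hφ.2, hψ.2, h T (by omega), ih (by omega)]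

/-- The infinitesimal character with the same values on trees as a given linear map. -/
def treePart (f : HRT K →ₗ[K] A) : HRT K →ₗ[K] A :=
  (basisMonomials RTree K).constr K fun s =>
    if s.degree = 1 then f (monomial s 1) else 0

theorem treePart_monomial (f : HRT K →ₗ[K] A) (s : RTree →₀ ℕ) :
    treePart f (monomial s 1) = if s.degree = 1 then f (monomial s 1) else 0 :=
  constr_monomial _ _

theorem treePart_X (f : HRT K →ₗ[K] A) (T : RTree) : treePart f (X T) = f (X T) := by
  rw [X, treePart_monomial, if_pos (by simp)]

theorem isInfinitesimalCharacter_treePart (f : HRT K →ₗ[K] A) :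
    IsInfinitesimalCharacter (treePart f) := by
  have h0 : treePart f 1 = 0 := by
    have := treePart_monomial f 0
    simpa using this
  refine isInfinitesimalCharacter_of_monomial fun s t => ?_
  by_cases hs : s = 0
  · subst hs
    simp [h0]
  by_cases ht : t = 0
  · subst ht
    simp [h0]
  rw [counit_monomial_of_ne_zero hs, counit_monomial_of_ne_zero ht, monomial_mul, one_mul,
    treePart_monomial, if_neg]
  · simp
  · have h1 := mt (Finsupp.degree_eq_zero_iff s).1 hs
    have h2 := mt (Finsupp.degree_eq_zero_iff t).1 ht
    rw [map_add]
    omega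

/-- Let `Z` be the infinitesimal character agreeing with `f = log φ` on trees. If `f` and `Z` agree
on forests with fewer than `n` vertices, then `exp f - exp Z` equals `f - Z` on forests with at most
`n` vertices. This vanishes on trees, so the characters `φ` and `exp Z` agree on trees with at most
`n` vertices, hence on such forests by multiplicativity, and so do `f` and `Z`. -/
theorem IsCharacter.isInfinitesimalCharacter_convLog [CharZero K] {φ : HRT K →ₗ[K] A}
    (hφ : IsCharacter φ) : IsInfinitesimalCharacter (convLog φ) := by
  set f : ConvAlg K A := clog (WithConv.toConv φ) with hf
  set Z := treePart f.ofConv with hZdef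
  have hZ : IsInfinitesimalCharacter Z := isInfinitesimalCharacter_treePart _
  have hf1 : f ∈ convFil K A 1 := clog_mem hφ.sub_one_mem
  have hfφ : cexp f = WithConv.toConv φ := cexp_clog hφ.sub_one_mem
  have key : ∀ n, f - WithConv.toConv Z ∈ convFil K A n := by
    intro n
    induction n with
    | zero => exact mem_convFil_zero _
    | succ n ih =>
      have h1 := cexp_congr hf1 hZ.mem_convFil ih
      have h2 : cexp f - cexp (WithConv.toConv Z) ∈ convFil K A (n + 1) := by
        rw [hfφ]
        refine hφ.sub_mem_convFil hZ.isCharacter_convExp fun T hT => ?_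
        have h3 := h1 (Finsupp.single T 1) (by rwa [forestDegree_single])
        rw [hfφ] at h3
        have h4 : (f - WithConv.toConv Z).ofConv (X T) = 0 := by
          rw [WithConv.ofConv_sub, LinearMap.sub_apply, sub_eq_zero]
          exact (treePart_X _ _).symm
        change _ - (f - WithConv.toConv Z).ofConv (X T) = 0 at h3
        rw [h4, sub_zero] at h3
        exact sub_eq_zero.1 h3
      simpa using sub_mem h2 h1
  have : f = WithConv.toConv Z := eq_of_sub_mem_convFil key
  have h5 : convLog φ = Z := congrArg WithConv.ofConv this
  rw [h5]
  exact hZ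

theorem bijOn_convExp [CharZero K] :
    Set.BijOn (convExp : (HRT K →ₗ[K] A) → (HRT K →ₗ[K] A))
      {Z | IsInfinitesimalCharacter Z} {φ | IsCharacter φ} := by
  refine ⟨fun Z hZ => IsInfinitesimalCharacter.isCharacter_convExp hZ, ?_, ?_⟩
  · intro Z hZ Z' hZ' h
    have h1 := clog_cexp (IsInfinitesimalCharacter.mem_convFil hZ)
    have h2 := clog_cexp (IsInfinitesimalCharacter.mem_convFil hZ')
    have h3 : cexp (WithConv.toConv Z) = cexp (WithConv.toConv Z') :=
      congrArg WithConv.toConv h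
    rw [h3, h2] at h1
    exact (WithConv.toConv_injective h1).symm
  · intro φ hφ
    exact ⟨convLog φ, IsCharacter.isInfinitesimalCharacter_convLog hφ,
      congrArg WithConv.ofConv (cexp_clog (IsCharacter.sub_one_mem hφ))⟩

theorem IsInfinitesimalCharacter.bch [CharZero K] {a b : HRT K →ₗ[K] A}
    (ha : IsInfinitesimalCharacter a) (hb : IsInfinitesimalCharacter b) :
    IsInfinitesimalCharacter (BCH a b) :=
  ((ha.isCharacter_convExp.conv hb.isCharacter_convExp).isInfinitesimalCharacter_convLog.sub
    ha).sub hb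

end Characters

/-! ### The recursion for `χ` and the Birkhoff decomposition -/

section Birkhoff

open MvPolynomial hiding counit

variable {K A : Type*} [Field K] [CommRing A] [Algebra K A]

/-- Composition with a linear map respects the filtration. -/
theorem comp_mem_convFil {n : ℕ} {f : HRT K →ₗ[K] A} (hf : WithConv.toConv f ∈ convFil K A n)
    (N : A →ₗ[K] A) : WithConv.toConv (N ∘ₗ f) ∈ convFil K A n := fun s hs => by
  change N (f _) = 0
  rw [show f (monomial s 1) = 0 from hf s hs, map_zero]

/-- The right hand side of the recursion for `χ`. -/
def chiStep (R : A →ₗ[K] A) (Z χ : HRT K →ₗ[K] A) : HRT K →ₗ[K] A :=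
  Z - BCH (R ∘ₗ χ) (rbTilde R ∘ₗ χ)

theorem chiStep_congr (R : A →ₗ[K] A) (Z : HRT K →ₗ[K] A) {χ χ' : HRT K →ₗ[K] A} {n : ℕ}
    (h1 : WithConv.toConv χ ∈ convFil K A 1) (h1' : WithConv.toConv χ' ∈ convFil K A 1)
    (h : WithConv.toConv χ - WithConv.toConv χ' ∈ convFil K A n) :
    WithConv.toConv (chiStep R Z χ) - WithConv.toConv (chiStep R Z χ') ∈ convFil K A (n + 1) := by
  have hN : ∀ N : A →ₗ[K] A,
      WithConv.toConv (N ∘ₗ χ) - WithConv.toConv (N ∘ₗ χ') ∈ convFil K A n := by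
    intro N
    have := comp_mem_convFil (f := χ - χ') h N
    rwa [LinearMap.comp_sub] at this
  have key := clog_mul_cexp_congr (comp_mem_convFil h1 R) (comp_mem_convFil h1' R)
    (comp_mem_convFil h1 (rbTilde R)) (comp_mem_convFil h1' (rbTilde R)) (hN R) (hN (rbTilde R))
  have e : ∀ a b : HRT K →ₗ[K] A, WithConv.toConv (BCH a b) =
      clog (cexp (WithConv.toConv a) * cexp (WithConv.toConv b)) - WithConv.toConv a -
        WithConv.toConv b := fun _ _ => rfl
  rw [chiStep, chiStep, WithConv.toConv_sub, WithConv.toConv_sub, e, e]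
  convert neg_mem key using 1
  abel

theorem IsInfinitesimalCharacter.chiStep [CharZero K] (R : A →ₗ[K] A) {Z χ : HRT K →ₗ[K] A}
    (hZ : IsInfinitesimalCharacter Z) (hχ : IsInfinitesimalCharacter χ) :
    IsInfinitesimalCharacter (chiStep R Z χ) :=
  hZ.sub ((hχ.comp R).bch (hχ.comp (rbTilde R)))

section Chi

variable [CharZero K] (R : A →ₗ[K] A) {Z : HRT K →ₗ[K] A}

theorem isInfinitesimalCharacter_chiApprox (hZ : IsInfinitesimalCharacter Z) (n : ℕ) :
    IsInfinitesimalCharacter (chiApprox R Z n) := by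
  induction n with
  | zero => exact hZ
  | succ n ih => exact hZ.chiStep R ih

theorem chiApprox_succ_sub_mem (hZ : IsInfinitesimalCharacter Z) (n : ℕ) :
    WithConv.toConv (chiApprox R Z (n + 1)) - WithConv.toConv (chiApprox R Z n) ∈
      convFil K A (n + 1) := by
  have h := isInfinitesimalCharacter_chiApprox R hZ
  induction n with
  | zero => exact sub_mem (h 1).mem_convFil (h 0).mem_convFil
  | succ n ih => exact chiStep_congr R Z (h (n + 1)).mem_convFil (h n).mem_convFil ih

theorem chiApprox_sub_mem (hZ : IsInfinitesimalCharacter Z) {m n : ℕ} (hmn : m ≤ n) :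
    WithConv.toConv (chiApprox R Z n) - WithConv.toConv (chiApprox R Z m) ∈
      convFil K A (m + 1) := by
  induction n, hmn using Nat.le_induction with
  | base => simp
  | succ n hmn ih =>
    have := add_mem (convFil_anti (by omega) (chiApprox_succ_sub_mem R hZ n)) ih
    simpa using this

theorem chi_sub_chiApprox_mem (hZ : IsInfinitesimalCharacter Z) (n : ℕ) :
    WithConv.toConv (chi R Z) - WithConv.toConv (chiApprox R Z n) ∈ convFil K A (n + 1) := by
  intro s hs
  have h := chiApprox_sub_mem R hZ (show forestDegree s ≤ n by omega) s (by omega)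
  rw [WithConv.ofConv_sub, LinearMap.sub_apply, sub_eq_zero] at h ⊢
  exact (constr_monomial _ _).trans h.symm

/-- The values of `χ` on `s`, `t` and `s + t` are all given by a single approximation, which is
already an infinitesimal character. -/
theorem isInfinitesimalCharacter_chi (hZ : IsInfinitesimalCharacter Z) :
    IsInfinitesimalCharacter (chi R Z) := by
  refine isInfinitesimalCharacter_of_monomial fun s t => ?_
  have h : ∀ r, forestDegree r ≤ forestDegree s + forestDegree t → chi R Z (monomial r 1) =
      chiApprox R Z (forestDegree s + forestDegree t) (monomial r 1) := fun r hr =>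
    sub_eq_zero.1 (chi_sub_chiApprox_mem R hZ (forestDegree s + forestDegree t) r (by omega))
  rw [h s (by omega), h t (by omega), monomial_mul, one_mul, h _ (forestDegree_add s t).le,
    ← isInfinitesimalCharacter_chiApprox R hZ, monomial_mul, one_mul]

theorem chi_eq (hZ : IsInfinitesimalCharacter Z) :
    chi R Z = Z - BCH (R ∘ₗ chi R Z) (rbTilde R ∘ₗ chi R Z) := by
  refine WithConv.toConv_injective (eq_of_sub_mem_convFil fun n => ?_)
  have h1 := chi_sub_chiApprox_mem R hZ (n + 1)
  have h2 := chiStep_congr R Z (isInfinitesimalCharacter_chiApprox R hZ n).mem_convFil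
    (isInfinitesimalCharacter_chi R hZ).mem_convFil
    (by simpa using neg_mem (chi_sub_chiApprox_mem R hZ n))
  have h3 := add_mem h1 h2
  refine convFil_anti (show n ≤ n + 1 + 1 by omega) ?_
  convert h3 using 1
  simp only [chiApprox, chiStep]
  abel

theorem eq_chi (hZ : IsInfinitesimalCharacter Z) {χ : HRT K →ₗ[K] A}
    (hχ : IsInfinitesimalCharacter χ)
    (h : χ = Z - BCH (R ∘ₗ χ) (rbTilde R ∘ₗ χ)) : χ = chi R Z := by
  refine WithConv.toConv_injective (eq_of_sub_mem_convFil fun n => ?_)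
  induction n with
  | zero => exact mem_convFil_zero _
  | succ n ih =>
    have := chiStep_congr R Z hχ.mem_convFil (isInfinitesimalCharacter_chi R hZ).mem_convFil ih
    rwa [chiStep, chiStep, ← h, ← chi_eq R hZ] at this

/-- The Birkhoff decomposition. -/
theorem cexp_eq_mul (hZ : IsInfinitesimalCharacter Z) :
    cexp (WithConv.toConv Z) =
    cexp (WithConv.toConv (R ∘ₗ chi R Z)) * WithConv.toConv (phiPlus R Z) := by
  have hχ := isInfinitesimalCharacter_chi R hZ
  have h1 := mul_sub_one_mem (cexp_sub_one_mem (hχ.comp R).mem_convFil)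
    (cexp_sub_one_mem (hχ.comp (rbTilde R)).mem_convFil)
  refine Eq.trans ?_ (cexp_clog h1)
  congr 1
  -- Replacing `χ` by `u + v` in the recursion cancels the linear terms of BCH and leaves `Z = log
  -- (exp u ⋆ exp v)`.
  have h2 : WithConv.toConv (R ∘ₗ chi R Z) + WithConv.toConv (rbTilde R ∘ₗ chi R Z) =
      WithConv.toConv (chi R Z) := by
    refine WithConv.ext (LinearMap.ext fun x => ?_)
    simp [rbTilde]
  have h3 : WithConv.toConv (chi R Z) = WithConv.toConv Z -
      (clog (cexp (WithConv.toConv (R ∘ₗ chi R Z)) *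
        cexp (WithConv.toConv (rbTilde R ∘ₗ chi R Z))) - WithConv.toConv (R ∘ₗ chi R Z) -
        WithConv.toConv (rbTilde R ∘ₗ chi R Z)) :=
    congrArg WithConv.toConv (chi_eq R hZ)
  rw [← h2] at h3
  set u := WithConv.toConv (R ∘ₗ chi R Z)
  set v := WithConv.toConv (rbTilde R ∘ₗ chi R Z)
  set L := clog (cexp u * cexp v)
  calc WithConv.toConv Z = WithConv.toConv Z - (L - u - v) + (L - u - v) := by abel
    _ = u + v + (L - u - v) := by rw [← h3]
    _ = L := by abel

theorem phiMinus_mul_cexp (hZ : IsInfinitesimalCharacter Z) :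
    WithConv.toConv (phiMinus R Z) * cexp (WithConv.toConv Z) =
    WithConv.toConv (phiPlus R Z) := by
  have hχ := isInfinitesimalCharacter_chi R hZ
  rw [cexp_eq_mul R hZ, ← mul_assoc]
  have : WithConv.toConv (phiMinus R Z) * cexp (WithConv.toConv (R ∘ₗ chi R Z)) = 1 :=
    cexp_neg_mul_cexp (hχ.comp R).mem_convFil
  rw [this, one_mul]

end Chi

/-- A linear map which is multiplicative on the double turns its convolution product into the
convolution product. -/
theorem comp_convDouble {R N : A →ₗ[K] A} (hN : ∀ a b, N (doubleMul R a b) = N a * N b)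
    (f g : HRT K →ₗ[K] A) : N ∘ₗ convDouble R f g = conv (N ∘ₗ f) (N ∘ₗ g) := by
  have key : ∀ z : HRT K ⊗[K] HRT K,
      N (LinearMap.mul' K A (TensorProduct.map f (R ∘ₗ g) z) +
        LinearMap.mul' K A (TensorProduct.map (R ∘ₗ f) g z) -
        LinearMap.mul' K A (TensorProduct.map f g z)) =
      LinearMap.mul' K A (TensorProduct.map (N ∘ₗ f) (N ∘ₗ g) z) := by
    intro z
    induction z with
    | zero => simp
    | add a b ha hb =>
      rw [map_add (TensorProduct.map (N ∘ₗ f) (N ∘ₗ g)), map_add (LinearMap.mul' K A), ← ha, ← hb,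
        ← map_add N]
      congr 1
      simp only [map_add]
      abel
    | tmul a b =>
      simp only [TensorProduct.map_tmul, LinearMap.mul'_apply, LinearMap.comp_apply, ← hN,
        doubleMul]
      congr 1
      ring
  exact LinearMap.ext fun x => key (coproduct K x)

theorem comp_convDoublePow {R N : A →ₗ[K] A} (hN : ∀ a b, N (doubleMul R a b) = N a * N b)
    (f : HRT K →ₗ[K] A) (n : ℕ) :
    WithConv.toConv (N ∘ₗ convDoublePow R f n) = WithConv.toConv (N ∘ₗ f) ^ (n + 1) := by
  induction n with
  | zero => rw [zero_add, pow_one]; rfl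
  | succ n ih =>
    rw [pow_succ', ← ih, convDoublePow, comp_convDouble hN]
    rfl

/-- Powers in the double are carried to convolution powers. The subtracted `1` is the term of order
zero, which `convDoubleExp` omits. -/
theorem comp_convDoubleExp {R N : A →ₗ[K] A} (hN : ∀ a b, N (doubleMul R a b) = N a * N b)
    {f : HRT K →ₗ[K] A} (hf : WithConv.toConv f ∈ convFil K A 1) :
    WithConv.toConv (N ∘ₗ convDoubleExp R f) = cexp (WithConv.toConv (N ∘ₗ f)) - 1 := by
  refine WithConv.ext (hrt_hom_ext K fun s => ?_)
  have h1 : ∀ n, N (convDoublePow R f n (monomial s 1)) =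
      (WithConv.toConv (N ∘ₗ f) ^ (n + 1)).ofConv (monomial s 1) := fun n =>
    congrArg (fun g : ConvAlg K A => g.ofConv (monomial s 1)) (comp_convDoublePow hN f n)
  rw [WithConv.ofConv_sub, LinearMap.sub_apply, cexp_apply (comp_mem_convFil hf N) le_rfl,
    Finset.sum_range_succ', WithConv.ofConv_toConv, LinearMap.comp_apply, convDoubleExp,
    constr_monomial, map_sum]
  simp [h1]

theorem apply_eq_zero_of_mem_convFil {f : ConvAlg K A} {m : ℕ} (hf : f ∈ convFil K A (m + 1))
    {x : HRT K} (hx : IsWeightedHomogeneous RTree.size x m) : f.ofConv x = 0 := by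
  rw [x.as_sum, map_sum]
  refine Finset.sum_eq_zero fun s hs => ?_
  have h1 : forestDegree s = m := by
    rw [← hx (mem_support_iff.1 hs), Finsupp.weight_apply]
    rfl
  rw [show (monomial s (coeff s x) : HRT K) = coeff s x • monomial s 1 by
    rw [smul_monomial, smul_eq_mul, mul_one], map_smul, hf s (by omega), smul_zero]

theorem cexp_apply_of_homogeneous {f : ConvAlg K A} (hf : f ∈ convFil K A 1) {m : ℕ}
    {x : HRT K} (hx : IsWeightedHomogeneous RTree.size x m) : (cexp f).ofConv x =
      ∑ n ∈ Finset.range (m + 1), ((n.factorial : K)⁻¹) • (f ^ n).ofConv x := by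
  have := apply_eq_zero_of_mem_convFil (cexp_sub_mem hf m) hx
  rw [WithConv.ofConv_sub, LinearMap.sub_apply, sub_eq_zero] at this
  rw [this, expPoly, map_sum, WithConv.ofConv_sum, LinearMap.sum_apply]
  simp [← Algebra.smul_def]

/-- The product of two exponentials on an element of degree `m`. -/
theorem cexp_mul_cexp_apply [CharZero K] {u v : ConvAlg K A} (hu : u ∈ convFil K A 1)
    (hv : v ∈ convFil K A 1) {m : ℕ} {x : HRT K} (hx : IsWeightedHomogeneous RTree.size x m)
    (hx0 : counit K x = 0) : (cexp u * cexp v).ofConv x = (cexp u).ofConv x + (cexp v).ofConv x +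
      ∑ n ∈ Finset.range (m + 1), ((n.factorial : K)⁻¹) •
        ∑ j ∈ Finset.Ico 1 n, (n.choose j : K) • (u ^ (n - j) * v ^ j).ofConv x := by
  set f : ℕ → ℕ → A := fun i j =>
    ((i.factorial : K)⁻¹ * (j.factorial : K)⁻¹) • (u ^ i * v ^ j).ofConv x with hf
  have h0 : f 0 0 = 0 := by
    simp only [hf, pow_zero, mul_one, convAlg_one_apply, hx0, map_zero, smul_zero]
  have h1 : (cexp u * cexp v).ofConv x =
      ∑ i ∈ Finset.range (m + 1), ∑ j ∈ Finset.range (m + 1), f i j := by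
    have := apply_eq_zero_of_mem_convFil
      (mul_sub_mul_mem_convFil (cexp_sub_mem hu m) (cexp_sub_mem hv m)) hx
    rw [WithConv.ofConv_sub, LinearMap.sub_apply, sub_eq_zero] at this
    rw [this, expPoly, map_sum, map_sum, Finset.sum_mul_sum, WithConv.ofConv_sum,
      LinearMap.sum_apply]
    refine Finset.sum_congr rfl fun i _ => ?_
    rw [WithConv.ofConv_sum, LinearMap.sum_apply]
    refine Finset.sum_congr rfl fun j _ => ?_
    simp only [map_mul, map_pow, Polynomial.aeval_X, Polynomial.aeval_C, ← Algebra.smul_def,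
      smul_mul_smul_comm, WithConv.ofConv_smul, LinearMap.smul_apply, hf]
  have h2 : (cexp u).ofConv x = ∑ n ∈ Finset.range (m + 1), f n 0 := by
    rw [cexp_apply_of_homogeneous hu hx]
    simp only [hf, pow_zero, mul_one, Nat.factorial_zero, Nat.cast_one, inv_one]
  have h3 : (cexp v).ofConv x = ∑ n ∈ Finset.range (m + 1), f 0 n := by
    rw [cexp_apply_of_homogeneous hv hx]
    simp only [hf, pow_zero, one_mul, Nat.factorial_zero, Nat.cast_one, inv_one]
  rw [h1, h2, h3, ← sum_antidiagonal_eq_sum_sum, ← Finset.sum_add_distrib,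
    ← Finset.sum_add_distrib]
  · refine Finset.sum_congr rfl fun n _ => ?_
    rw [Finset.Nat.sum_antidiagonal_eq_sum_range_succ f, ← Finset.sum_range_reflect,
      Finset.smul_sum]
    have h4 : ∑ j ∈ Finset.Ico 1 n, ((n.factorial : K)⁻¹) • (n.choose j : K) •
        (u ^ (n - j) * v ^ j).ofConv x = ∑ j ∈ Finset.Ico 1 n, f (n - j) j := by
      refine Finset.sum_congr rfl fun j hj => ?_
      rw [Finset.mem_Ico] at hj
      obtain ⟨i, rfl⟩ := Nat.exists_eq_add_of_le' hj.2.le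
      rw [smul_smul, ← Nat.choose_symm_add, inv_factorial_mul_choose, Nat.add_sub_cancel]
    have h5 : ∀ j ∈ Finset.range (n + 1), f (n + 1 - 1 - j) (n - (n + 1 - 1 - j)) =
        f (n - j) j := by
      intro j hj
      rw [Finset.mem_range] at hj
      congr 1
      omega
    rw [h4, Finset.sum_congr rfl h5]
    -- The terms `j = 0` and `j = n` belong to the two separate exponentials. For `n = 0` they
    -- coincide and are counted twice, which is harmless because `f 0 0` is the counit of `x`, hence
    -- zero.
    rcases n with _ | n
    · simp [h0]
    · rw [Finset.sum_range_succ, Finset.range_eq_Ico, Finset.sum_eq_sum_Ico_succ_bot (by omega)]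
      simp only [Nat.sub_self, Nat.sub_zero, zero_add]
      abel
  · intro i j hij
    have h6 := mul_mem_convFil (pow_mem_convFil hu i) (pow_mem_convFil hv j)
    simp only [hf]
    rw [apply_eq_zero_of_mem_convFil (convFil_anti hij h6) hx, smul_zero]

end Birkhoff

/-! ### The Bogoliubov character and the explicit formulae -/

section BogoliubovCharacter

variable {K A : Type*} [Field K] [CommRing A] [Algebra K A]

theorem IsRotaBaxter.map_doubleMul {R : A →ₗ[K] A} (hR : IsRotaBaxter R) (a b : A) :
    R (doubleMul R a b) = R a * R b := by
  rw [doubleMul, map_sub, ← hR a b, add_sub_cancel_right]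

theorem IsRotaBaxter.neg_rbTilde_map_doubleMul {R : A →ₗ[K] A} (hR : IsRotaBaxter R) (a b : A) :
    (-rbTilde R) (doubleMul R a b) = (-rbTilde R) a * (-rbTilde R) b := by
  simp only [rbTilde, LinearMap.neg_apply, LinearMap.sub_apply, LinearMap.id_apply,
    hR.map_doubleMul]
  rw [doubleMul]
  ring

theorem conv_treeEl {φ ψ : HRT K →ₗ[K] A} (hφ : φ 1 = 1) (hψ : ψ 1 = 1) (t : PTree) :
    conv φ ψ (treeEl K t) = φ (treeEl K t) + (ψ (treeEl K t) +
      ∑ C ∈ PTree.cuts t, φ (prunedPart K C) * ψ (rootPart K C)) := by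
  have h : conv φ ψ (treeEl K t) =
      LinearMap.mul' K A (TensorProduct.map φ ψ (coproduct K (treeEl K t))) := rfl
  rw [h, coproduct_treeEl_eq, map_add, map_add, map_add, map_add, map_sum, map_sum]
  simp [hφ, hψ, add_assoc]

variable [CharZero K] {R : A →ₗ[K] A} {Z : HRT K →ₗ[K] A}

theorem isCharacter_phiMinus (R : A →ₗ[K] A) (hZ : IsInfinitesimalCharacter Z) :
    IsCharacter (phiMinus R Z) :=
  ((isInfinitesimalCharacter_chi R hZ).comp R).neg.isCharacter_convExp

theorem isCharacter_phiPlus (R : A →ₗ[K] A) (hZ : IsInfinitesimalCharacter Z) :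
    IsCharacter (phiPlus R Z) :=
  ((isInfinitesimalCharacter_chi R hZ).comp (rbTilde R)).isCharacter_convExp

theorem map_bogoliubov (hR : IsRotaBaxter R) (hZ : IsInfinitesimalCharacter Z) {x : HRT K}
    (hx : counit K x = 0) : R (bogoliubov R Z x) = phiMinus R Z x := by
  have h := comp_convDoubleExp hR.map_doubleMul (isInfinitesimalCharacter_chi R hZ).neg.mem_convFil
  have h1 := congrArg (fun f : ConvAlg K A => f.ofConv x) h
  simp only [WithConv.ofConv_sub, LinearMap.sub_apply, convAlg_one_apply, hx, map_zero, sub_zero,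
    LinearMap.comp_neg] at h1
  exact h1

theorem neg_rbTilde_bogoliubov (hR : IsRotaBaxter R) (hZ : IsInfinitesimalCharacter Z) {x : HRT K}
    (hx : counit K x = 0) : -rbTilde R (bogoliubov R Z x) = phiPlus R Z x := by
  have h := comp_convDoubleExp hR.neg_rbTilde_map_doubleMul
    (isInfinitesimalCharacter_chi R hZ).neg.mem_convFil
  have h1 := congrArg (fun f : ConvAlg K A => f.ofConv x) h
  simp only [WithConv.ofConv_sub, LinearMap.sub_apply, convAlg_one_apply, hx, map_zero, sub_zero,
    LinearMap.comp_neg, LinearMap.neg_comp, neg_neg] at h1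
  exact h1

/-- The identity is `R - (-(id - R))`, the difference of the two morphisms out of the double. -/
theorem bogoliubov_eq_sub (hR : IsRotaBaxter R) (hZ : IsInfinitesimalCharacter Z) {x : HRT K}
    (hx : counit K x = 0) : bogoliubov R Z x = phiMinus R Z x - phiPlus R Z x := by
  rw [← map_bogoliubov hR hZ hx, ← neg_rbTilde_bogoliubov hR hZ hx]
  simp [rbTilde]

/-- Writing `b = φ₋ - φ₊` and `R b = φ₋`, the product in the double becomes `φ₋ x * φ₋ y - φ₊ x * φ₊
y`. So multiplicativity follows from that of the two factors, without expanding powers in the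
double. -/
theorem bogoliubov_mul (hR : IsRotaBaxter R) (hZ : IsInfinitesimalCharacter Z) {x y : HRT K}
    (hx : counit K x = 0) (hy : counit K y = 0) :
    bogoliubov R Z (x * y) = doubleMul R (bogoliubov R Z x) (bogoliubov R Z y) := by
  have hxy : counit K (x * y) = 0 := by rw [map_mul, hx, zero_mul]
  rw [bogoliubov_eq_sub hR hZ hxy, (isCharacter_phiMinus R hZ).2, (isCharacter_phiPlus R hZ).2,
    doubleMul, map_bogoliubov hR hZ hx, map_bogoliubov hR hZ hy, bogoliubov_eq_sub hR hZ hx,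
    bogoliubov_eq_sub hR hZ hy]
  ring

/-- The factors are determined by the difference `p = φ₊(x) - φ₋(x)`. -/
theorem phi_eq_of_phiPlus_eq (hR : IsRotaBaxter R) (hZ : IsInfinitesimalCharacter Z) {x : HRT K}
    (hx : counit K x = 0) {p : A} (hp : phiPlus R Z x = phiMinus R Z x + p) :
    phiMinus R Z x = -R p ∧ phiPlus R Z x = rbTilde R p := by
  have h : bogoliubov R Z x = -p := by rw [bogoliubov_eq_sub hR hZ hx, hp]; ring
  constructor
  · rw [← map_bogoliubov hR hZ hx, h, map_neg]
  · rw [← neg_rbTilde_bogoliubov hR hZ hx, h, map_neg, neg_neg]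

/-- This is `φ₊ = φ₋ ⋆ φ` with both exponentials expanded: the pure powers give `φ₋` and `φ`, the
remaining ones the mixed terms. -/
theorem phiPlus_eq_add_mixedTerms (R : A →ₗ[K] A) (hZ : IsInfinitesimalCharacter Z) {m : ℕ}
    {x : HRT K} (hx : MvPolynomial.IsWeightedHomogeneous RTree.size x m) (hx0 : counit K x = 0) :
    phiPlus R Z x = phiMinus R Z x + (convExp Z x + mixedTerms R Z m x) := by
  have hχ := (isInfinitesimalCharacter_chi R hZ).comp R
  have h := congrArg (fun f : ConvAlg K A => f.ofConv x) (phiMinus_mul_cexp R hZ)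
  have h1 := cexp_mul_cexp_apply hχ.neg.mem_convFil hZ.mem_convFil hx hx0
  refine h.symm.trans (h1.trans ?_)
  rw [add_assoc, mixedTerms, LinearMap.sum_apply]
  congr 2
  refine Finset.sum_congr rfl fun n _ => ?_
  rw [LinearMap.smul_apply, LinearMap.sum_apply]
  congr 1
  refine Finset.sum_congr rfl fun j _ => ?_
  rw [LinearMap.smul_apply, LinearMap.comp_neg, ← toConv_convPow, ← toConv_convPow]
  rfl

theorem phiPlus_treeEl (R : A →ₗ[K] A) (hZ : IsInfinitesimalCharacter Z) (t : PTree) :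
    phiPlus R Z (treeEl K t) = phiMinus R Z (treeEl K t) + (convExp Z (treeEl K t) +
      ∑ C ∈ PTree.cuts t, phiMinus R Z (prunedPart K C) * convExp Z (rootPart K C)) := by
  have h : conv (phiMinus R Z) (convExp Z) = phiPlus R Z :=
    congrArg WithConv.ofConv (phiMinus_mul_cexp R hZ)
  rw [← h, conv_treeEl (isCharacter_phiMinus R hZ).1 hZ.isCharacter_convExp.1]

end BogoliubovCharacter

end

theorem theorem4p11 {K A : Type*} [Field K] [CharZero K] [CommRing A] [Algebra K A]
    (R : A →ₗ[K] A) (hR : IsRotaBaxter R) :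
    -- characters and their generators
    Set.BijOn (convExp : (HRT K →ₗ[K] A) → (HRT K →ₗ[K] A))
      {Z | IsInfinitesimalCharacter Z} {φ | IsCharacter φ} ∧
    ∀ Z φ : HRT K →ₗ[K] A, IsInfinitesimalCharacter Z → convExp Z = φ →
      -- `χ(Z)` is the unique infinitesimal character solving the defining recursion
      (IsInfinitesimalCharacter (chi R Z) ∧
        chi R Z = Z - BCH (R ∘ₗ chi R Z) (rbTilde R ∘ₗ chi R Z) ∧
        ∀ χ : HRT K →ₗ[K] A, IsInfinitesimalCharacter χ →
          χ = Z - BCH (R ∘ₗ χ) (rbTilde R ∘ₗ χ) → χ = chi R Z) ∧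
      -- the Birkhoff decomposition `φ = φ₋⁻¹ ⋆ φ₊`, with `φ₋⁻¹ = exp (R ∘ χ(Z))`
      (IsCharacter (phiMinus R Z) ∧ IsCharacter (phiPlus R Z) ∧
        conv (phiMinus R Z) (convExp (R ∘ₗ chi R Z)) = convOne K A ∧
        conv (convExp (R ∘ₗ chi R Z)) (phiMinus R Z) = convOne K A ∧
        φ = conv (convExp (R ∘ₗ chi R Z)) (phiPlus R Z)) ∧
      -- `b[φ]` is multiplicative with values in the double
      (∀ x y : HRT K, counit K x = 0 → counit K y = 0 →
        bogoliubov R Z (x * y) = doubleMul R (bogoliubov R Z x) (bogoliubov R Z y)) ∧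
      -- the factors are the images of `b[φ]`
      (∀ x : HRT K, counit K x = 0 →
        R (bogoliubov R Z x) = phiMinus R Z x ∧
        -rbTilde R (bogoliubov R Z x) = phiPlus R Z x) ∧
      -- the formulae in terms of convolution powers
      (∀ (m : ℕ) (x : HRT K), MvPolynomial.IsWeightedHomogeneous RTree.size x m →
        counit K x = 0 →
        phiMinus R Z x = -R (φ x + mixedTerms R Z m x) ∧
        phiPlus R Z x = rbTilde R (φ x + mixedTerms R Z m x)) ∧
      -- Bogoliubov's recursion over admissible cuts
      (∀ t : PTree,
        phiMinus R Z (treeEl K t) =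
          -R (φ (treeEl K t) +
            ∑ C ∈ PTree.cuts t, phiMinus R Z (prunedPart K C) * φ (rootPart K C)) ∧
        phiPlus R Z (treeEl K t) =
          rbTilde R (φ (treeEl K t) +
            ∑ C ∈ PTree.cuts t, phiMinus R Z (prunedPart K C) * φ (rootPart K C))) := by
  refine ⟨bijOn_convExp, ?_⟩
  rintro Z _ hZ rfl
  have hχ := (isInfinitesimalCharacter_chi R hZ).comp R
  refine ⟨⟨isInfinitesimalCharacter_chi R hZ, chi_eq R hZ, fun χ hχ' h => eq_chi R hZ hχ' h⟩,
    ⟨isCharacter_phiMinus R hZ, isCharacter_phiPlus R hZ,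
      congrArg WithConv.ofConv (cexp_neg_mul_cexp hχ.mem_convFil),
      congrArg WithConv.ofConv (cexp_mul_cexp_neg hχ.mem_convFil),
      congrArg WithConv.ofConv (cexp_eq_mul R hZ)⟩,
    fun x y hx hy => bogoliubov_mul hR hZ hx hy,
    fun x hx => ⟨map_bogoliubov hR hZ hx, neg_rbTilde_bogoliubov hR hZ hx⟩,
    fun m x hx hx0 => phi_eq_of_phiPlus_eq hR hZ hx0 (phiPlus_eq_add_mixedTerms R hZ hx hx0),
    fun t => phi_eq_of_phiPlus_eq hR hZ (by simp [treeEl, counit]) (phiPlus_treeEl R hZ t)⟩
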